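/- Let $M=\mathbb R^4$ be Minkowski spacetime with $p\cdot x=p_0x_0-p_1x_1-p_2x_2-p_3x_3$; points $x,y$ are spacelike separated if $(x-y)\cdot(x-y)<0$, and $\overline V_+=\{p: p_0\ge 0,\ p\cdot p\ge 0\}$ is the closed forward light cone. Let $\mathcal H$ be a complex Hilbert space and let $U$ denote a strongly continuous unitary representation of the translation group $\mathbb R^4$ on $\mathcal H$. Its spectrum $\mathrm{sp}(U)$ is the joint spectrum of the four-momentum $P$, where $U(x)=e^{iP\cdot x}$; that is, the set of all $p$ such that $\int\varphi(x)e^{ip\cdot x}\,dx=0$ for every Schwartz function $\varphi$ with $\int\varphi(x)U(x)\,dx=0$. $U$ satisfies the spectrum condition if $\mathrm{sp}(U)\subseteq\overline V_+$. (1) Theorem. Suppose that $A:M\to\mathfrak B(\mathcal H)$ is an operator-valued function and $U$ is as above, such that: (i) microcausality: $[A(x),A(y)]=0$ and $[A(x),A(y)^*]=0$ whenever $x$ and $y$ are spacelike separated (the second condition coincides with the first when the operators $A(x)$ are self-adjoint); (ii) $U(x)A(y)U(x)^*=A(y-x)$ for all $x,y\in M$; (iii) $U$ satisfies the spectrum condition;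 (iv) there is a unique (up to scalar multiples) nonzero translation-invariant vector $\Omega\in\mathcal H$. Then there is a $c\in\mathbb C$ such that $A(x)\Omega=c\,\Omega$ for all $x\in M$. (2) Corollary. Let $\mathcal K$ be the set of open double cones in $M$, i.e. the nonempty intersections of the open chronological future of a point with the open chronological past of another. Let $O\mapsto\mathcal R(O)$ be an isotonous net of von Neumann algebras on $\mathcal H$, indexed by $O\in\mathcal K$, which acts irreducibly (the commutant of $\bigcup_O\mathcal R(O)$ is $\mathbb CI$) and satisfies microcausality ($\mathcal R(O_1)$ and $\mathcal R(O_2)$ commute elementwise whenever $O_1,O_2\in\mathcal K$ are spacelike separated). Suppose that $U$ is as above and implements the translations, $U(a)\mathcal R(O)U(a)^*=\mathcal R(O+a)$ for all $a$ and $O$, that $U$ satisfies the spectrum condition, and that there is a nonzero translation-invariant vector $\Omega\in\mathcal H$. Then for each $x\in M$, $$\bigcap_{\{O\in\mathcal K\,:\,x\in O\}}\mathcal R(O)=\mathbb C I.$$ -/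

import Mathlib

noncomputable section

namespace AQFT

open MeasureTheory
open scoped SchwartzMap

/-- Four-dimensional Minkowski spacetime, identified with its translation group after a choice of
origin. The coordinate `0` is time; the Euclidean structure of `EuclideanSpace` is used only for the
topology, for Lebesgue measure and for Schwartz functions. -/
abbrev Minkowski : Type := EuclideanSpace ℝ (Fin 4)

/-- The Lorentzian form, of signature `(+,-,-,-)`. -/
def lorentz (x y : Minkowski) : ℝ := x 0 * y 0 - x 1 * y 1 - x 2 * y 2 - x 3 * y 3

/-- Two points are spacelike separated. -/
def SpacelikeSep (x y : Minkowski) : Prop := lorentz (x - y) (x - y) < 0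

/-- The closed forward light cone. -/
def forwardCone : Set Minkowski := {p | 0 ≤ p 0 ∧ 0 ≤ lorentz p p}

/-- The chronological future of a point. -/
def future (x : Minkowski) : Set Minkowski := {z | 0 < (z - x) 0 ∧ 0 < lorentz (z - x) (z - x)}

/-- The chronological past of a point. -/
def past (y : Minkowski) : Set Minkowski := {z | y ∈ future z}

/-- Open double cones. -/
def IsDoubleCone (O : Set Minkowski) : Prop :=
  ∃ x y : Minkowski, y ∈ future x ∧ O = future x ∩ past y

/-- The set of all open double cones. -/
abbrev DoubleCone : Type := {O : Set Minkowski // IsDoubleCone O}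

/-- The translate `O + a` of a set. -/
def translateSet (a : Minkowski) (O : Set Minkowski) : Set Minkowski := {z | z - a ∈ O}

theorem IsDoubleCone.translate {O : Set Minkowski} (hO : IsDoubleCone O) (a : Minkowski) :
    IsDoubleCone (translateSet a O) := by
  obtain ⟨x, y, hxy, rfl⟩ := hO
  refine ⟨x + a, y + a, ?_, ?_⟩
  · have h : y + a - (x + a) = y - x := by abel
    simpa only [future, Set.mem_ofPred_eq, h] using hxy
  · ext z
    have h1 : z - (x + a) = z - a - x := by abel
    have h2 : y + a - z = y - (z - a) := by abel
    simp only [translateSet, future, past, Set.mem_ofPred_eq, Set.mem_inter_iff, h1, h2]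

/-- The translate `O + a` of a double cone. -/
def DoubleCone.translate (a : Minkowski) (O : DoubleCone) : DoubleCone :=
  ⟨translateSet a O.1, O.2.translate a⟩

/-- Two double cones are spacelike separated. -/
def DoubleCone.SpacelikeSep (O₁ O₂ : DoubleCone) : Prop :=
  ∀ x ∈ O₁.1, ∀ y ∈ O₂.1, AQFT.SpacelikeSep x y

section Hilbert

variable (H : Type*) [NormedAddCommGroup H] [InnerProductSpace ℂ H] [CompleteSpace H]

/-- A strongly continuous unitary representation of the translation group on `H`. -/
structure TranslationRep where
  /-- the underlying group homomorphism -/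
  toHom : Multiplicative Minkowski →* unitary (H →L[ℂ] H)
  /-- strong continuity -/
  continuous_apply : ∀ v : H,
    Continuous fun x : Minkowski => (toHom (Multiplicative.ofAdd x) : H →L[ℂ] H) v

/-- A net of von Neumann algebras on `H` over the double cones, with isotony. -/
structure Net where
  /-- the local algebra of a double cone -/
  alg : DoubleCone → VonNeumannAlgebra H
  /-- isotony -/
  isotony : ∀ O₁ O₂ : DoubleCone, O₁.1 ⊆ O₂.1 → alg O₁ ≤ alg O₂

variable {H}

/-- The operator `U(x)`. -/
def TranslationRep.op (U : TranslationRep H) (x : Minkowski) : H →L[ℂ] H :=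
  (U.toHom (Multiplicative.ofAdd x) : H →L[ℂ] H)

/-- A vector invariant under all translations. -/
def TranslationRep.Invariant (U : TranslationRep H) (v : H) : Prop :=
  ∀ x : Minkowski, U.op x v = v

/-- The smeared operator `U(φ) = ∫ φ(x) U(x) dx`, applied to a vector. -/
def TranslationRep.smear (U : TranslationRep H) (φ : 𝓢(Minkowski, ℂ)) (v : H) : H :=
  ∫ x : Minkowski, φ x • U.op x v

/-- The Fourier transform `∫ φ(x) exp (i p·x) dx`, with the Lorentzian pairing `p·x`. -/
def lorentzFourier (φ : 𝓢(Minkowski, ℂ)) (p : Minkowski) : ℂ :=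
  ∫ x : Minkowski, φ x * Complex.exp (Complex.I * (lorentz p x : ℂ))

/-- The spectrum `sp(U)`: all momenta `p` such that `U(φ) = 0` forces the Fourier transform of `φ`
to vanish at `p`. This is the joint spectrum of the four-momentum `P`, where
`U(x) = exp (i P·x)`. -/
def TranslationRep.sp (U : TranslationRep H) : Set Minkowski :=
  {p | ∀ φ : 𝓢(Minkowski, ℂ), (∀ v : H, U.smear φ v = 0) → lorentzFourier φ p = 0}

/-- The spectrum condition. -/
def TranslationRep.SpectrumCondition (U : TranslationRep H) : Prop := U.sp ⊆ forwardCone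

/-- Microcausality: algebras of spacelike separated double cones commute elementwise. -/
def Net.Microcausal (R : Net H) : Prop :=
  ∀ O₁ O₂ : DoubleCone, O₁.SpacelikeSep O₂ →
    ∀ S ∈ R.alg O₁, ∀ T ∈ R.alg O₂, S * T = T * S

/-- The local algebras together have trivial commutant. -/
def Net.Irreducible (R : Net H) : Prop :=
  Set.centralizer (⋃ O : DoubleCone, (R.alg O : Set (H →L[ℂ] H))) =
    Set.range fun c : ℂ => c • (1 : H →L[ℂ] H)

/-- `U` implements the translations of the net: `U(a) R(O) U(a)* = R(O + a)`. -/
def TranslationRep.Implements (U : TranslationRep H) (R : Net H) : Prop :=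
  ∀ (a : Minkowski) (O : DoubleCone),
    (fun T : H →L[ℂ] H => U.op a * T * star (U.op a)) '' (R.alg O : Set (H →L[ℂ] H)) =
      (R.alg (O.translate a) : Set (H →L[ℂ] H))

end Hilbert

end AQFT

end

/-! Everything rests on one-sided spectra. If `p · n ≥ 0` on the closed forward cone, each matrix
element `t ↦ ⟪u, U(t n) v⟫` has only nonnegative frequencies, hence behaves like the boundary value
of a bounded holomorphic function on the upper half-plane. Two consequences are used: it is constant
if its reflection is one-sided too (`OneSided.eq_const`), and it vanishes if it vanishes on an
interval (`OneSided.eq_zero`).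

Field at a point: put `a = A(0) Ω` and `b = A(0)* Ω`. Microcausality with the adjoint gives `⟪a,
U(-y) a⟫ = ⟪b, U(y) b⟫` for spacelike `y`, and by continuity for lightlike `y`. Along a lightlike
line the two sides have opposite spectra, so both are constant, which forces `U(y) a = a`. Lightlike
vectors span, so `a` is invariant, hence a multiple of `Ω`; covariance does the rest.

Algebra at a point: the same argument makes `A Ω` invariant. For local `B`, far spacelike translates
of `A` commute with `B`, so `A U(x) B Ω = U(x) B A Ω` for `x` far away. Uniqueness along two
lightlike directions carries this to `x = 0`, so `A B Ω = B A Ω`. The vectors `B Ω` are dense by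
irreducibility, so `A` commutes with the net and is a scalar. Uniqueness of the vacuum is not needed
here.

The test-function definition of `sp(U)` is converted into one-sidedness by Gelfand theory:
characters of the algebra generated by the translations that survive smearing are plane waves with
momentum in `sp(U)` (`TranslationRep.integral_smul_op_eq_zero`). -/

noncomputable section

namespace AQFT

open MeasureTheory Filter Topology Complex
open scoped SchwartzMap

/-! ### Cauchy kernels and functions with one-sided spectrum -/

/-- A function pairs to zero with every integrable function whose Fourier transform
`∫ f(t) exp (i s t) dt` vanishes for `s ≥ 0`. -/
def OneSided (h : ℝ → ℂ) : Prop :=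
  ∀ f : ℝ → ℂ, Integrable f → (∀ s : ℝ, 0 ≤ s → ∫ t : ℝ, f t * exp (I * (s * t : ℝ)) = 0) →
    ∫ t : ℝ, f t * h t = 0

theorem one_add_sq_le (z : ℂ) {r : ℝ} (hr : 0 < r) :
    ∃ C : ℝ, 0 < C ∧ ∀ t : ℝ, r ≤ ‖(t : ℂ) - z‖ → 1 + t ^ 2 ≤ C ^ 2 * ‖(t : ℂ) - z‖ ^ 2 := by
  refine ⟨2 + (1 + 2 * ‖z‖ ^ 2) / r ^ 2, by positivity, fun t ht => ?_⟩
  have h1 : ‖(t : ℂ)‖ ≤ ‖(t : ℂ) - z‖ + ‖z‖ := by simpa using norm_add_le ((t : ℂ) - z) z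
  have h2 : t ^ 2 = ‖(t : ℂ)‖ ^ 2 := by simp
  have h3 : r ^ 2 ≤ ‖(t : ℂ) - z‖ ^ 2 := by gcongr
  -- From `t² ≤ 2 w² + 2 ‖z‖²`, the constant part being absorbed by `w² / r² ≥ 1`. Since `C ≥ 1`,
  -- the bound survives with `C²`, the shape in which two such bounds multiply to a perfect square.
  set C := 2 + (1 + 2 * ‖z‖ ^ 2) / r ^ 2 with hC
  set w := ‖(t : ℂ) - z‖
  have h4 : 1 + t ^ 2 ≤ C * w ^ 2 := by
    have : (1 + 2 * ‖z‖ ^ 2) ≤ (1 + 2 * ‖z‖ ^ 2) / r ^ 2 * w ^ 2 := by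
      rw [div_mul_eq_mul_div, le_div_iff₀ (by positivity)]
      gcongr
    have h5 : ‖(t : ℂ)‖ ^ 2 ≤ (w + ‖z‖) ^ 2 := by gcongr
    rw [hC, h2]
    nlinarith [sq_nonneg (w - ‖z‖)]
  have hC1 : 1 ≤ C := by
    have : 0 ≤ (1 + 2 * ‖z‖ ^ 2) / r ^ 2 := by positivity
    linarith
  nlinarith [mul_nonneg (sub_nonneg.2 hC1) (sq_nonneg w), sq_nonneg w]

theorem sub_ofReal_ne_zero {z : ℂ} (hz : z.im ≠ 0) (t : ℝ) : (t : ℂ) - z ≠ 0 := by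
  intro h
  apply hz
  rw [← sub_eq_zero.1 h, ofReal_im]

theorem abs_im_le_norm_sub (z : ℂ) (t : ℝ) : |z.im| ≤ ‖(t : ℂ) - z‖ := by
  simpa using abs_im_le_norm ((t : ℂ) - z)

/-- `1 / ((t - z) (t - w))` is integrable on the line. -/
theorem integrable_inv_mul_inv {z w : ℂ} (hz : z.im ≠ 0) (hw : w.im ≠ 0) :
    Integrable fun t : ℝ => ((t : ℂ) - z)⁻¹ * ((t : ℂ) - w)⁻¹ := by
  obtain ⟨C, hC, h1⟩ := one_add_sq_le z (abs_pos.2 hz)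
  obtain ⟨D, hD, h2⟩ := one_add_sq_le w (abs_pos.2 hw)
  refine (integrable_inv_one_add_sq.const_mul (C * D)).mono' ?_ (ae_of_all _ fun t => ?_)
  · refine Continuous.aestronglyMeasurable (Continuous.mul ?_ ?_)
    · exact Continuous.inv₀ (by fun_prop) (sub_ofReal_ne_zero hz)
    · exact Continuous.inv₀ (by fun_prop) (sub_ofReal_ne_zero hw)
  · have e1 := h1 t (abs_im_le_norm_sub z t)
    have e2 := h2 t (abs_im_le_norm_sub w t)
    have p1 : 0 < ‖(t : ℂ) - z‖ := norm_pos_iff.2 (sub_ofReal_ne_zero hz t)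
    have p2 : 0 < ‖(t : ℂ) - w‖ := norm_pos_iff.2 (sub_ofReal_ne_zero hw t)
    rw [norm_mul, norm_inv, norm_inv, ← mul_inv, ← div_eq_mul_inv, ← one_div,
      div_le_div_iff₀ (by positivity) (by positivity)]
    have : (1 + t ^ 2) ^ 2 ≤ (C * D * (‖(t : ℂ) - z‖ * ‖(t : ℂ) - w‖)) ^ 2 := by
      calc (1 + t ^ 2) ^ 2 = (1 + t ^ 2) * (1 + t ^ 2) := by ring
        _ ≤ (C ^ 2 * ‖(t : ℂ) - z‖ ^ 2) * (D ^ 2 * ‖(t : ℂ) - w‖ ^ 2) := by gcongr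
        _ = _ := by ring
    simpa using (abs_le_of_sq_le_sq' this (by positivity)).2

theorem inv_sub_inv_eq {z w : ℂ} (hz : z.im ≠ 0) (hw : w.im ≠ 0) (t : ℝ) :
    ((t : ℂ) - z)⁻¹ - ((t : ℂ) - w)⁻¹ = (z - w) * (((t : ℂ) - z)⁻¹ * ((t : ℂ) - w)⁻¹) := by
  have h1 := sub_ofReal_ne_zero hz t
  have h2 := sub_ofReal_ne_zero hw t
  field_simp
  ring

theorem integrable_inv_sub_inv {z w : ℂ} (hz : z.im ≠ 0) (hw : w.im ≠ 0) :
    Integrable fun t : ℝ => ((t : ℂ) - z)⁻¹ - ((t : ℂ) - w)⁻¹ := by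
  simp_rw [inv_sub_inv_eq hz hw]
  exact (integrable_inv_mul_inv hz hw).const_mul _

/-- The function `exp (-2πi l z)` on the nonnegative half-line, extended by zero. -/
def halfExp (z : ℂ) (l : ℝ) : ℂ := if 0 ≤ l then exp (-(2 * Real.pi * I * z) * l) else 0

theorem halfExp_eq_indicator (z : ℂ) :
    halfExp z = (Set.Ici 0).indicator fun l : ℝ => exp (-(2 * Real.pi * I * z) * l) := by
  ext l
  simp [halfExp, Set.indicator_apply]

theorem re_lt {z : ℂ} (hz : z.im < 0) : (-(2 * Real.pi * I * z)).re < 0 := by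
  simp
  have := Real.pi_pos
  nlinarith

theorem integrable_halfExp {z : ℂ} (hz : z.im < 0) : Integrable (halfExp z) := by
  rw [halfExp_eq_indicator, integrable_indicator_iff measurableSet_Ici,
    integrableOn_Ici_iff_integrableOn_Ioi]
  exact integrableOn_exp_mul_complex_Ioi (re_lt hz) 0

theorem fourierInv_halfExp {z : ℂ} (hz : z.im < 0) (t : ℝ) :
    FourierTransformInv.fourierInv (halfExp z) t = I / (2 * Real.pi) * ((t : ℂ) - z)⁻¹ := by
  rw [Real.fourierInv_eq']
  have e : ∀ v : ℝ, Complex.exp (((2 * Real.pi * inner ℝ v t : ℝ) : ℂ) * I) • halfExp z v =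
      halfExp (z - t) v := by
    intro v
    unfold halfExp
    split_ifs
    · rw [smul_eq_mul, ← Complex.exp_add]
      congr 1
      simp
      ring
    · simp
  have hz' : (z - t).im < 0 := by simpa using hz
  simp_rw [e]
  rw [halfExp_eq_indicator, integral_indicator measurableSet_Ici, integral_Ici_eq_integral_Ioi,
    integral_exp_mul_complex_Ioi (re_lt hz')]
  have h1 := sub_ofReal_ne_zero hz.ne t
  have h2 : z - t ≠ 0 := by rwa [← neg_sub, neg_ne_zero]
  have h3 : (Real.pi : ℂ) ≠ 0 := by exact_mod_cast Real.pi_ne_zero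
  simp only [ofReal_zero, mul_zero, Complex.exp_zero]
  field_simp
  rw [I_sq]
  ring

/-- The difference of two Cauchy kernels with poles in the lower half-plane has a Fourier
transform carried by the negative half-line. -/
theorem fourier_inv_sub_inv {z w : ℂ} (hz : z.im < 0) (hw : w.im < 0) {s : ℝ} (hs : 0 ≤ s) :
    ∫ t : ℝ, (((t : ℂ) - z)⁻¹ - ((t : ℂ) - w)⁻¹) * exp (I * (s * t : ℝ)) = 0 := by
  set g : ℝ → ℂ := fun l => halfExp z l - halfExp w l with hg
  have gi : Integrable g := (integrable_halfExp hz).sub (integrable_halfExp hw)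
  -- Each half-line exponential jumps from 0 to 1 at the origin; the jumps cancel in the difference,
  -- so Fourier inversion holds pointwise.
  have gc : Continuous g := by
    have : g = fun l : ℝ => if 0 ≤ l then exp (-(2 * Real.pi * I * z) * l) -
        exp (-(2 * Real.pi * I * w) * l) else 0 := by
      ext l
      simp only [hg, halfExp]
      split_ifs <;> simp
    rw [this]
    refine Continuous.if_le (by fun_prop) continuous_const continuous_const continuous_id ?_
    intro x hx
    simp [← hx]
  have e : FourierTransformInv.fourierInv g =
      fun t : ℝ => I / (2 * Real.pi) * (((t : ℂ) - z)⁻¹ - ((t : ℂ) - w)⁻¹) := by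
    ext t
    rw [mul_sub, ← fourierInv_halfExp hz, ← fourierInv_halfExp hw, Real.fourierInv_eq',
      Real.fourierInv_eq', Real.fourierInv_eq', ← integral_sub]
    · simp only [hg, smul_sub]
    · exact (Real.fourierIntegral_convergent_iff (-t)).2 (integrable_halfExp hz) |>.congr
        (ae_of_all _ fun v => by simp [Circle.smul_def, Real.fourierChar_apply])
    · exact (Real.fourierIntegral_convergent_iff (-t)).2 (integrable_halfExp hw) |>.congr
        (ae_of_all _ fun v => by simp [Circle.smul_def, Real.fourierChar_apply])
  have fi : Integrable (FourierTransformInv.fourierInv g) := by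
    rw [e]
    exact (integrable_inv_sub_inv hz.ne hw.ne).const_mul _
  have key : FourierTransform.fourier (FourierTransformInv.fourierInv g) = g := by
    refine gc.fourier_fourierInv_eq gi ?_
    have := fi.comp_neg
    refine this.congr (ae_of_all _ fun v => ?_)
    simp [Real.fourierInv_eq_fourier_neg]
  -- At `s = 0` the two exponentials cancel; for `s > 0` the point lies off the support.
  have h0 : g (-(s / (2 * Real.pi))) = 0 := by
    have hp := Real.pi_pos
    rcases hs.eq_or_lt with rfl | hs
    · simp [hg, halfExp]
    · have : ¬ (0 ≤ -(s / (2 * Real.pi))) := by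
        have : 0 < s / (2 * Real.pi) := by positivity
        linarith
      simp only [hg, halfExp, if_neg this, sub_zero]
  rw [← key, e, Real.fourier_eq'] at h0
  have h3 : (Real.pi : ℂ) ≠ 0 := by exact_mod_cast Real.pi_ne_zero
  have h4 : I / (2 * Real.pi) * ∫ t : ℝ, (((t : ℂ) - z)⁻¹ - ((t : ℂ) - w)⁻¹) * exp (I * (s * t : ℝ)) = 0 := by
    rw [← integral_const_mul, ← h0]
    congr 1
    ext t
    rw [smul_eq_mul]
    have : (((-2 * Real.pi * inner ℝ t (-(s / (2 * Real.pi))) : ℝ) : ℂ) * I) = I * (s * t : ℝ) := by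
      simp
      field_simp
    rw [this]
    ring
  refine (mul_eq_zero.1 h4).resolve_left ?_
  exact div_ne_zero I_ne_zero (by simp)

/-- This is the form in which one-sidedness is used: poles in the lower half-plane can be moved
freely. -/
theorem OneSided.integral_kernel {h : ℝ → ℂ} (hh : OneSided h) {z w : ℂ} (hz : z.im < 0)
    (hw : w.im < 0) : ∫ t : ℝ, (((t : ℂ) - z)⁻¹ - ((t : ℂ) - w)⁻¹) * h t = 0 :=
  hh _ (integrable_inv_sub_inv hz.ne hw.ne) fun _ hs => fourier_inv_sub_inv hz hw hs

theorem inv_sub_conj_inv_eq (x s : ℝ) {y : ℝ} (hy : 0 < y) :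
    (((x + y * s : ℝ) : ℂ) - (x + y * I))⁻¹ - (((x + y * s : ℝ) : ℂ) - (x - y * I))⁻¹ =
      y⁻¹ * (2 * I * ((1 + s ^ 2 : ℝ) : ℂ)⁻¹) := by
  have hy' : (y : ℂ) ≠ 0 := by exact_mod_cast hy.ne'
  have h1 : (s : ℂ) - I ≠ 0 := sub_ofReal_ne_zero (by simp) s
  have h2 : (s : ℂ) + I ≠ 0 := by
    simpa using sub_ofReal_ne_zero (z := -I) (by simp) s
  have h3 : ((1 + s ^ 2 : ℝ) : ℂ) = (s - I) * (s + I) := by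
    push_cast
    ring_nf
    rw [I_sq]
    ring
  have h4 : ((x + y * s : ℝ) : ℂ) - (x + y * I) = y * (s - I) := by push_cast; ring
  have h5 : ((x + y * s : ℝ) : ℂ) - (x - y * I) = y * (s + I) := by push_cast; ring
  rw [h3, h4, h5, ofReal_inv]
  field_simp
  ring

theorem integrable_bdd_mul {k h : ℝ → ℂ} (hk : Integrable k) (hc : Continuous h) {M : ℝ}
    (hM : ∀ t, ‖h t‖ ≤ M) : Integrable fun t => k t * h t :=
  hk.mul_bdd hc.aestronglyMeasurable (ae_of_all _ hM)

/-- A bounded continuous function whose Poisson integral is constant along a vertical half-line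
takes that constant as its boundary value. -/
theorem eq_of_poisson_eq {h : ℝ → ℂ} (hc : Continuous h) {M : ℝ} (hM : ∀ t, ‖h t‖ ≤ M)
    (x : ℝ) (c : ℂ) (hp : ∀ y : ℝ, 0 < y →
      ∫ t : ℝ, (((t : ℂ) - (x + y * I))⁻¹ - ((t : ℂ) - (x - y * I))⁻¹) * h t = c) :
    h x = c / (2 * I * Real.pi) := by
  have e : ∀ y : ℝ, 0 < y →
      ∫ s : ℝ, (2 * I * ((1 + s ^ 2 : ℝ) : ℂ)⁻¹) * h (x + y * s) = c := by
    intro y hy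
    have hy' : (y : ℂ) ≠ 0 := by exact_mod_cast hy.ne'
    rw [← hp y hy]
    set G : ℝ → ℂ := fun t => (((t : ℂ) - (x + y * I))⁻¹ - ((t : ℂ) - (x - y * I))⁻¹) * h t with hG
    -- The substitution `t = x + y s` turns the Poisson kernel into a fixed integrable kernel, so
    -- that `y → 0` is a dominated limit.
    have h1 := Measure.integral_comp_mul_left (fun t => G (x + t)) y
    rw [integral_add_left_eq_self G x, abs_of_pos (inv_pos.2 hy)] at h1
    have h2 : ∀ s : ℝ, (2 * I * ((1 + s ^ 2 : ℝ) : ℂ)⁻¹) * h (x + y * s) = y * G (x + y * s) := by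
      intro s
      rw [hG]
      simp only
      rw [inv_sub_conj_inv_eq x s hy, ← mul_assoc, ← mul_assoc]
      rw [ofReal_inv, mul_inv_cancel₀ hy', one_mul]
    simp_rw [h2]
    rw [integral_const_mul, h1, real_smul, ofReal_inv, ← mul_assoc, mul_inv_cancel₀ hy', one_mul]
  have lim : Tendsto (fun y : ℝ => ∫ s : ℝ, (2 * I * ((1 + s ^ 2 : ℝ) : ℂ)⁻¹) * h (x + y * s))
      (𝓝[>] 0) (𝓝 (∫ s : ℝ, (2 * I * ((1 + s ^ 2 : ℝ) : ℂ)⁻¹) * h x)) := by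
    refine tendsto_integral_filter_of_dominated_convergence
      (fun s => 2 * (1 + s ^ 2)⁻¹ * M) ?_ ?_ ?_ ?_
    · refine Eventually.of_forall fun y => Continuous.aestronglyMeasurable ?_
      refine Continuous.mul (continuous_const.mul (Continuous.inv₀ (by fun_prop) ?_)) (by fun_prop)
      intro s
      have : (0 : ℝ) < 1 + s ^ 2 := by positivity
      exact_mod_cast this.ne'
    · refine Eventually.of_forall fun y => ae_of_all _ fun s => ?_
      have : (0 : ℝ) < 1 + s ^ 2 := by positivity
      rw [norm_mul, norm_mul, norm_mul, norm_I, norm_inv, norm_real, Real.norm_of_nonneg this.le]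
      simp only [norm_ofNat, mul_one]
      gcongr
      exact hM _
    · exact (integrable_inv_one_add_sq.const_mul 2).mul_const M
    · refine ae_of_all _ fun s => ?_
      refine Tendsto.mono_left ?_ nhdsWithin_le_nhds
      have : Continuous fun y : ℝ => (2 * I * ((1 + s ^ 2 : ℝ) : ℂ)⁻¹) * h (x + y * s) := by fun_prop
      simpa using this.tendsto 0
  have lim' : Tendsto (fun _ : ℝ => c) (𝓝[>] 0) _ := lim.congr'
    (eventually_nhdsWithin_of_forall fun y hy => e y hy)
  have h1 := tendsto_nhds_unique lim' tendsto_const_nhds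
  rw [integral_mul_const, integral_const_mul] at h1
  have h2 : ∫ s : ℝ, ((1 + s ^ 2 : ℝ) : ℂ)⁻¹ = (Real.pi : ℂ) := by
    rw [← integral_univ_inv_one_add_sq, ← integral_complex_ofReal]
    simp
  rw [h2] at h1
  have h3 : (Real.pi : ℂ) ≠ 0 := by exact_mod_cast Real.pi_ne_zero
  rw [← h1, mul_div_cancel_left₀]
  simp [h3]

/-- Only frequency zero is left. Concretely, the Poisson kernel is a difference of Cauchy kernels
with conjugate poles; `hh` moves the lower pole and `hh'` the upper one, so the Poisson integral is
the same at every point. -/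
theorem OneSided.eq_const {h : ℝ → ℂ} (hh : OneSided h) (hh' : OneSided fun t => h (-t))
    (hc : Continuous h) {M : ℝ} (hM : ∀ t, ‖h t‖ ≤ M) (x : ℝ) : h x = h 0 := by
  have key : ∀ x y : ℝ, 0 < y →
      ∫ t : ℝ, (((t : ℂ) - (x + y * I))⁻¹ - ((t : ℂ) - (x - y * I))⁻¹) * h t =
        ∫ t : ℝ, (((t : ℂ) - I)⁻¹ - ((t : ℂ) - (-I))⁻¹) * h t := by
    intro x y hy
    have i1 : (x + y * I : ℂ).im = y := by simp
    have i2 : (x - y * I : ℂ).im = -y := by simp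
    have h1 := hh.integral_kernel (z := -I) (w := x - y * I) (by simp) (by simp [hy])
    have h2 : ∫ t : ℝ, (((t : ℂ) - (x + y * I))⁻¹ - ((t : ℂ) - I)⁻¹) * h t = 0 := by
      rw [← integral_neg_eq_self]
      have := hh'.integral_kernel (z := -(x + y * I)) (w := -I) (by simp [hy]) (by simp)
      rw [← neg_eq_zero, ← integral_neg, ← this]
      congr 1
      ext t
      have e1 : ((-t : ℝ) : ℂ) - (x + y * I) = -((t : ℂ) - -(x + y * I)) := by push_cast; ring
      have e2 : ((-t : ℝ) : ℂ) - I = -((t : ℂ) - -I) := by push_cast; ring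
      rw [e1, e2, inv_neg, inv_neg]
      ring
    have j1 := integrable_bdd_mul (integrable_inv_sub_inv (z := -I) (w := x - y * I) (by simp)
      (by simp [hy.ne'])) hc hM
    have j2 := integrable_bdd_mul (integrable_inv_sub_inv (z := x + y * I) (w := I)
      (by simp [hy.ne']) (by simp)) hc hM
    have j3 := integrable_bdd_mul (integrable_inv_sub_inv (z := I) (w := -I) (by simp)
      (by simp)) hc hM
    rw [← sub_eq_zero, ← integral_sub _ j3]
    · rw [← add_zero (0 : ℂ)]
      nth_rw 1 [← h1]
      rw [← h2, ← integral_add j1 j2]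
      congr 1
      ext t
      ring
    · exact integrable_bdd_mul (integrable_inv_sub_inv (by simp [hy.ne']) (by simp [hy.ne'])) hc hM
  rw [eq_of_poisson_eq hc hM x _ (key x), eq_of_poisson_eq hc hM 0 _ (key 0)]

/-- The regularized Cauchy integral of a bounded function is holomorphic off its support. -/
theorem differentiableAt_cauchy {h : ℝ → ℂ} (hc : Continuous h) {M : ℝ} (hM : ∀ t, ‖h t‖ ≤ M)
    {z₀ : ℂ} {r : ℝ} (hr : 0 < r) (hs : ∀ t, h t ≠ 0 → r ≤ ‖(t : ℂ) - z₀‖) :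
    DifferentiableAt ℂ
      (fun z => ∫ t : ℝ, (((t : ℂ) - z)⁻¹ - ((t : ℂ) - (-I))⁻¹) * h t) z₀ := by
  obtain ⟨C, hC, hCb⟩ := one_add_sq_le z₀ hr
  obtain ⟨D, hD, hDb⟩ := one_add_sq_le (-I) (r := 1) one_pos
  have hM0 : 0 ≤ M := (norm_nonneg _).trans (hM 0)
  have meas : ∀ z : ℂ, AEStronglyMeasurable
      (fun t : ℝ => (((t : ℂ) - z)⁻¹ - ((t : ℂ) - (-I))⁻¹) * h t) volume := by
    intro z
    refine Measurable.aestronglyMeasurable ?_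
    have := hc.measurable
    fun_prop
  have hI : ∀ t : ℝ, 1 ≤ ‖(t : ℂ) - -I‖ := fun t => by
    simpa using abs_im_le_norm_sub (-I) t
  have hmain := hasDerivAt_integral_of_dominated_loc_of_deriv_le (μ := volume)
    (F := fun z (t : ℝ) => (((t : ℂ) - z)⁻¹ - ((t : ℂ) - (-I))⁻¹) * h t)
    (F' := fun z (t : ℝ) => (((t : ℂ) - z) ^ 2)⁻¹ * h t) (x₀ := z₀)
    (bound := fun t => 4 * C ^ 2 * M * (1 + t ^ 2)⁻¹) (s := Metric.ball z₀ (r / 2))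
    (Metric.ball_mem_nhds _ (by positivity)) (Eventually.of_forall meas) ?_ ?_ ?_ ?_ ?_
  · exact hmain.2.differentiableAt
  · refine (integrable_inv_one_add_sq.const_mul (‖z₀ + I‖ * C * D * M)).mono' (meas _)
      (ae_of_all _ fun t => ?_)
    by_cases ht : h t = 0
    · simp only [ht, mul_zero, norm_zero]; positivity
    have p1 : 0 < ‖(t : ℂ) - z₀‖ := hr.trans_le (hs t ht)
    have p2 : 0 < ‖(t : ℂ) - -I‖ := one_pos.trans_le (hI t)
    have e : ((t : ℂ) - z₀)⁻¹ - ((t : ℂ) - (-I))⁻¹ =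
        (z₀ + I) * (((t : ℂ) - z₀)⁻¹ * ((t : ℂ) - -I)⁻¹) := by
      have := norm_pos_iff.1 p1
      have := norm_pos_iff.1 p2
      field_simp
      ring
    have hb : (‖(t : ℂ) - z₀‖)⁻¹ * (‖(t : ℂ) - -I‖)⁻¹ ≤ C * D * (1 + t ^ 2)⁻¹ := by
      rw [← mul_inv, ← div_eq_mul_inv, ← one_div,
        div_le_div_iff₀ (by positivity) (by positivity)]
      have : (1 + t ^ 2) ^ 2 ≤ (C * D * (‖(t : ℂ) - z₀‖ * ‖(t : ℂ) - -I‖)) ^ 2 := by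
        calc (1 + t ^ 2) ^ 2 = (1 + t ^ 2) * (1 + t ^ 2) := by ring
          _ ≤ (C ^ 2 * ‖(t : ℂ) - z₀‖ ^ 2) * (D ^ 2 * ‖(t : ℂ) - -I‖ ^ 2) := by
            gcongr
            · exact hCb t (hs t ht)
            · exact hDb t (hI t)
          _ = _ := by ring
      simpa using (abs_le_of_sq_le_sq' this (by positivity)).2
    rw [e, norm_mul, norm_mul, norm_mul, norm_inv, norm_inv]
    calc ‖z₀ + I‖ * ((‖(t : ℂ) - z₀‖)⁻¹ * (‖(t : ℂ) - -I‖)⁻¹) * ‖h t‖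
        ≤ ‖z₀ + I‖ * (C * D * (1 + t ^ 2)⁻¹) * M := by gcongr; exact hM t
      _ = _ := by ring
  · refine Measurable.aestronglyMeasurable ?_
    have := hc.measurable
    fun_prop
  · refine ae_of_all _ fun t z hz => ?_
    by_cases ht : h t = 0
    · simp only [ht, mul_zero, norm_zero]; positivity
    have p1 := hs t ht
    -- Halving the radius keeps `z` at distance at least `r / 2` from the support of `h`, uniformly
    -- on the ball.
    have p2 : ‖(t : ℂ) - z₀‖ ≤ 2 * ‖(t : ℂ) - z‖ := by
      have h1 := norm_add_le ((t : ℂ) - z) (z - z₀)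
      rw [sub_add_sub_cancel] at h1
      have h2 : ‖z - z₀‖ < r / 2 := by simpa [dist_eq_norm] using hz
      linarith
    have p3 : 0 < ‖(t : ℂ) - z‖ := by linarith
    have hb : (‖(t : ℂ) - z‖ ^ 2)⁻¹ ≤ 4 * C ^ 2 * (1 + t ^ 2)⁻¹ := by
      rw [← div_eq_mul_inv, ← one_div, div_le_div_iff₀ (by positivity) (by positivity), one_mul]
      calc 1 + t ^ 2 ≤ C ^ 2 * ‖(t : ℂ) - z₀‖ ^ 2 := hCb t p1
        _ ≤ C ^ 2 * (2 * ‖(t : ℂ) - z‖) ^ 2 := by gcongr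
        _ = _ := by ring
    rw [norm_mul, norm_inv, norm_pow]
    calc (‖(t : ℂ) - z‖ ^ 2)⁻¹ * ‖h t‖ ≤ (4 * C ^ 2 * (1 + t ^ 2)⁻¹) * M := by
          gcongr; exact hM t
      _ = _ := by ring
  · exact integrable_inv_one_add_sq.const_mul _
  · refine ae_of_all _ fun t z hz => ?_
    by_cases ht : h t = 0
    · simp only [ht, mul_zero]; exact hasDerivAt_const _ _
    have p1 := hs t ht
    have p3 : (t : ℂ) - z ≠ 0 := by
      intro h0
      have h2 : ‖z - z₀‖ < r / 2 := by simpa [dist_eq_norm] using hz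
      rw [← sub_eq_zero.1 h0] at h2
      linarith
    have := ((((hasDerivAt_id z).const_sub (t : ℂ)).inv p3).sub_const
      (((t : ℂ) - (-I))⁻¹)).mul_const (h t)
    exact this.congr_deriv (by simp)

/-- This supplies connectedness of the two half-planes joined through the gap `(a, b)`, as the
identity theorem requires. -/
theorem starConvex_slit {a b m : ℝ} (hm : m ∈ Set.Ioo a b) :
    StarConvex ℝ (m : ℂ) {z : ℂ | z.im ≠ 0 ∨ z.re ∈ Set.Ioo a b} := by
  intro z hz p q hp hq hpq
  rcases hq.eq_or_lt with rfl | hq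
  · right
    have : p = 1 := by linarith
    simpa [this] using hm
  rcases hz with hz | hz
  · left
    simpa using ⟨hq.ne', hz⟩
  · right
    simpa using convex_Ioo a b hm hz hp hq.le hpq

/-- A bounded continuous function with one-sided spectrum which vanishes on an interval
vanishes identically. -/
theorem OneSided.eq_zero {h : ℝ → ℂ} (hh : OneSided h) (hc : Continuous h) {M : ℝ}
    (hM : ∀ t, ‖h t‖ ≤ M) {a b : ℝ} (hab : a < b) (h0 : ∀ t ∈ Set.Ioo a b, h t = 0) (x : ℝ) :
    h x = 0 := by
  set F : ℂ → ℂ := fun z => ∫ t : ℝ, (((t : ℂ) - z)⁻¹ - ((t : ℂ) - (-I))⁻¹) * h t with hF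
  have hFlow : ∀ z : ℂ, z.im < 0 → F z = 0 := fun z hz => hh.integral_kernel hz (by simp)
  set S : Set ℂ := {z : ℂ | z.im ≠ 0 ∨ z.re ∈ Set.Ioo a b} with hS
  have hSo : IsOpen S := by
    refine IsOpen.union ?_ ?_
    · exact isOpen_ne_fun continuous_im continuous_const
    · exact isOpen_Ioo.preimage continuous_re
  have hm : (a + b) / 2 ∈ Set.Ioo a b := ⟨by linarith, by linarith⟩
  have hSc : IsPreconnected S :=
    ((starConvex_slit hm).isPathConnected (Or.inr hm)).isConnected.isPreconnected
  have hd : DifferentiableOn ℂ F S := by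
    intro z hz
    refine DifferentiableAt.differentiableWithinAt ?_
    rcases hz with hz | hz
    · exact differentiableAt_cauchy hc hM (abs_pos.2 hz) fun t _ => abs_im_le_norm_sub z t
    · refine differentiableAt_cauchy hc hM (r := min (z.re - a) (b - z.re))
        (lt_min (by linarith [hz.1]) (by linarith [hz.2])) fun t ht => ?_
      have h1 : |t - z.re| ≤ ‖(t : ℂ) - z‖ := by simpa using abs_re_le_norm ((t : ℂ) - z)
      refine le_trans ?_ h1
      have h2 : t ∉ Set.Ioo a b := fun h => ht (h0 t h)
      rw [Set.mem_Ioo, not_and_or, not_lt, not_lt] at h2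
      rcases h2 with h2 | h2
      · exact (min_le_left _ _).trans (by rw [abs_sub_comm]; exact (by linarith : _ ≤ z.re - t).trans (le_abs_self _))
      · exact (min_le_right _ _).trans ((by linarith : _ ≤ t - z.re).trans (le_abs_self _))
  -- `F` vanishes on the lower half-plane, and the identity theorem carries this through the gap to
  -- the upper one. The Poisson integral is the difference of `F` at conjugate points, hence zero.
  have hz : Set.EqOn F 0 S := by
    refine (hd.analyticOnNhd hSo).eqOn_zero_of_preconnected_of_eventuallyEq_zero hSc
      (z₀ := -I) (Or.inl (by simp)) ?_
    filter_upwards [(isOpen_lt continuous_im continuous_const).mem_nhds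
      (show (-I).im < 0 by simp)] with z hz using hFlow z hz
  have := eq_of_poisson_eq hc hM x 0 fun y hy => by
    have i1 : (x + y * I : ℂ).im ≠ 0 := by simp [hy.ne']
    have i2 : (x - y * I : ℂ).im ≠ 0 := by simp [hy.ne']
    have e : F (x + y * I) - F (x - y * I) = 0 := by
      rw [hz (Or.inl i1), hz (Or.inl i2)]; simp
    rw [← e, hF]
    simp only
    rw [← integral_sub]
    · congr 1
      ext t
      ring
    · exact integrable_bdd_mul (integrable_inv_sub_inv i1 (by simp)) hc hM
    · exact integrable_bdd_mul (integrable_inv_sub_inv i2 (by simp)) hc hM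
  simpa using this

/-! ### Continuous characters -/

/-- Continuous one-parameter groups of complex numbers of modulus at most one. -/
theorem exists_eq_exp {φ : ℝ → ℂ} (hc : Continuous φ) (h0 : φ 0 = 1)
    (hadd : ∀ s t, φ (s + t) = φ s * φ t) (hb : ∀ t, ‖φ t‖ ≤ 1) :
    ∃ c : ℝ, ∀ t : ℝ, φ t = exp (I * (c * t : ℝ)) := by
  set Φ : ℝ → ℂ := fun s => ∫ t in (0 : ℝ)..s, φ t with hΦ
  have dΦ : ∀ s, HasDerivAt Φ (φ s) s := fun s =>
    intervalIntegral.integral_hasDerivAt_right (hc.intervalIntegrable _ _)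
      (hc.stronglyMeasurableAtFilter _ _) hc.continuousAt
  obtain ⟨δ, hδ⟩ : ∃ δ, Φ δ ≠ 0 := by
    by_contra! h
    have h1 : HasDerivAt Φ 0 0 := by
      rw [show Φ = fun _ => 0 from funext h]
      exact hasDerivAt_const _ _
    have := h1.unique (dΦ 0)
    rw [h0] at this
    exact zero_ne_one this
  -- Integrating the functional equation over `[0, δ]` expresses `φ` through its primitive, so
  -- continuity upgrades to differentiability.
  have e : φ = fun s => (Φ (s + δ) - Φ s) / Φ δ := by
    ext s
    rw [eq_div_iff hδ, hΦ]
    simp only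
    rw [intervalIntegral.integral_interval_sub_left (hc.intervalIntegrable _ _)
      (hc.intervalIntegrable _ _), ← intervalIntegral.integral_const_mul]
    simp_rw [← hadd]
    rw [intervalIntegral.integral_comp_add_left φ s, add_zero]
  have d0 : ∀ s, DifferentiableAt ℝ φ s := by
    intro s
    rw [e]
    exact ((((dΦ (s + δ)).comp_add_const s δ).sub (dΦ s)).div_const _).differentiableAt
  set a := deriv φ 0 with ha
  have d1 : ∀ s, HasDerivAt φ (φ s * a) s := by
    intro s
    have h1 : HasDerivAt (fun t => φ (s + t)) (φ s * a) 0 := by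
      simp_rw [hadd]
      exact (d0 0).hasDerivAt.const_mul _
    have h2 : HasDerivAt (fun t => φ (s + t)) (deriv φ s) 0 :=
      HasDerivAt.comp_const_add s 0 (by simpa using (d0 s).hasDerivAt)
    rw [h1.unique h2]
    exact (d0 s).hasDerivAt
  have d2 : ∀ s, HasDerivAt (fun s : ℝ => φ s * exp (-(s * a))) 0 s := by
    intro s
    have h1 : HasDerivAt (fun s : ℝ => exp (-(s * a))) (exp (-(s * a)) * -(1 * a)) s :=
      ((((hasDerivAt_id s).ofReal_comp).mul_const a).neg).cexp
    exact ((d1 s).mul h1).congr_deriv (by ring)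
  have hexp : ∀ s : ℝ, φ s = exp (s * a) := by
    intro s
    have := is_const_of_deriv_eq_zero (fun s => (d2 s).differentiableAt) (fun s => (d2 s).deriv) s 0
    simp only [h0, ofReal_zero, zero_mul, neg_zero, Complex.exp_zero, one_mul] at this
    rw [Complex.exp_neg] at this
    exact (mul_inv_eq_one₀ (exp_ne_zero _)).1 this
  -- Boundedness at `1` and at `-1` gives the two inequalities.
  have hre : a.re = 0 := by
    have h1 := hb 1
    have h2 := hb (-1)
    rw [hexp, norm_exp, Real.exp_le_one_iff] at h1 h2
    simp at h1 h2
    linarith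
  refine ⟨a.im, fun t => ?_⟩
  rw [hexp]
  congr 1
  apply Complex.ext <;> simp [hre, mul_comm]

theorem lorentz_smul_right (p x : Minkowski) (t : ℝ) : lorentz p (t • x) = lorentz p x * t := by
  simp [lorentz]; ring

/-- Continuous characters of Minkowski spacetime are plane waves. -/
theorem exists_eq_planeWave {χ : Minkowski → ℂ} (hc : Continuous χ) (h0 : χ 0 = 1)
    (hadd : ∀ x y, χ (x + y) = χ x * χ y) (hb : ∀ x, ‖χ x‖ ≤ 1) :
    ∃ p : Minkowski, ∀ x, χ x = exp (I * (lorentz p x : ℝ)) := by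
  have h1 : ∀ j : Fin 4, ∃ c : ℝ, ∀ t : ℝ,
      χ (t • EuclideanSpace.single j (1 : ℝ)) = exp (I * (c * t : ℝ)) := fun j =>
    exists_eq_exp (by fun_prop) (by simpa using h0)
      (fun s t => by rw [add_smul, hadd]) fun t => hb _
  choose c hcj using h1
  refine ⟨!₂[c 0, -c 1, -c 2, -c 3], fun x => ?_⟩
  have hx : x = x 0 • EuclideanSpace.single 0 (1 : ℝ) + x 1 • EuclideanSpace.single 1 (1 : ℝ) +
      x 2 • EuclideanSpace.single 2 (1 : ℝ) + x 3 • EuclideanSpace.single 3 (1 : ℝ) := by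
    ext i
    fin_cases i <;> simp
  conv_lhs => rw [hx]
  rw [hadd, hadd, hadd, hcj, hcj, hcj, hcj, ← exp_add, ← exp_add, ← exp_add]
  congr 1
  simp [lorentz]
  ring

/-! ### The translation algebra and the spectrum condition -/

section Rep

variable {H : Type*} [NormedAddCommGroup H] [InnerProductSpace ℂ H] [CompleteSpace H]

namespace TranslationRep

variable (U : TranslationRep H)

theorem op_zero : U.op 0 = 1 := by simp [op]

theorem op_add (x y : Minkowski) : U.op (x + y) = U.op x * U.op y := by simp [op]

theorem star_op (x : Minkowski) : star (U.op x) = U.op (-x) := by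
  simp only [op, ofAdd_neg, map_inv]
  rfl

theorem op_add_apply (x y : Minkowski) (v : H) : U.op (x + y) v = U.op x (U.op y v) := by
  rw [op_add]; rfl

theorem op_neg_op_apply (x : Minkowski) (v : H) : U.op (-x) (U.op x v) = v := by
  rw [← op_add_apply, neg_add_cancel, op_zero]; rfl

theorem op_op_neg_apply (x : Minkowski) (v : H) : U.op x (U.op (-x) v) = v := by
  rw [← op_add_apply, add_neg_cancel, op_zero]; rfl

theorem inner_op_right (x : Minkowski) (v w : H) :
    inner ℂ v (U.op x w) = inner ℂ (U.op (-x) v) w := by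
  rw [← star_op, ContinuousLinearMap.star_eq_adjoint, ContinuousLinearMap.adjoint_inner_left]

theorem norm_op_apply (x : Minkowski) (v : H) : ‖U.op x v‖ = ‖v‖ := by
  rw [← sq_eq_sq₀ (norm_nonneg _) (norm_nonneg _), ← inner_self_eq_norm_sq (𝕜 := ℂ), inner_op_right,
    op_neg_op_apply, inner_self_eq_norm_sq]

theorem norm_op_le (x : Minkowski) : ‖U.op x‖ ≤ 1 :=
  ContinuousLinearMap.opNorm_le_bound _ zero_le_one fun v => by rw [norm_op_apply, one_mul]

theorem continuous_op_apply (v : H) : Continuous fun x => U.op x v := U.continuous_apply v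

section Smear
variable {α : Type*} [TopologicalSpace α] [SecondCountableTopology α] [MeasurableSpace α]
  [OpensMeasurableSpace α] {μ : Measure α}

theorem integrable_smul_op {f : α → ℂ} (hf : Integrable f μ) {γ : α → Minkowski}
    (hγ : Continuous γ) (v : H) : Integrable (fun t => f t • U.op (γ t) v) μ :=
  hf.smul_bdd ‖v‖ ((U.continuous_op_apply v).comp hγ).aestronglyMeasurable
    (ae_of_all _ fun _ => (U.norm_op_apply _ v).le)

theorem integrable_smul_op_self {μ : Measure Minkowski} {f : Minkowski → ℂ} (hf : Integrable f μ)
    (v : H) : Integrable (fun x => f x • U.op x v) μ :=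
  U.integrable_smul_op hf continuous_id v

/-- The operator `∫ f(t) U(γ(t)) dt`. -/
theorem exists_smearOp {f : α → ℂ} (hf : Integrable f μ) {γ : α → Minkowski}
    (hγ : Continuous γ) : ∃ T : H →L[ℂ] H, ∀ v, T v = ∫ t, f t • U.op (γ t) v ∂μ := by
  let T₀ : H →ₗ[ℂ] H :=
    { toFun := fun v => ∫ t, f t • U.op (γ t) v ∂μ
      map_add' := fun v w => by
        rw [← integral_add (U.integrable_smul_op hf hγ v) (U.integrable_smul_op hf hγ w)]
        simp only [map_add, smul_add]
      map_smul' := fun c v => by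
        rw [RingHom.id_apply, ← integral_smul]
        simp only [map_smul, smul_comm c] }
  refine ⟨T₀.mkContinuous (∫ t, ‖f t‖ ∂μ) fun v => ?_, fun v => rfl⟩
  refine (norm_integral_le_integral_norm _).trans (le_of_eq ?_)
  simp only [norm_smul, norm_op_apply]
  rw [integral_mul_const]

theorem commute_smearOp {f : α → ℂ} (hf : Integrable f μ) {γ : α → Minkowski}
    (hγ : Continuous γ) {T B : H →L[ℂ] H} (hT : ∀ v, T v = ∫ t, f t • U.op (γ t) v ∂μ)
    (hB : ∀ x, U.op x * B = B * U.op x) : T * B = B * T := by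
  ext v
  change T (B v) = B (T v)
  rw [hT, hT, ← B.integral_comp_comm (U.integrable_smul_op hf hγ v)]
  congr 1
  ext t
  rw [map_smul]
  exact congrArg (f t • ·) (DFunLike.congr_fun (hB (γ t)) v)
end Smear

/-- The commutative von Neumann algebra generated by the translations. -/
def translationAlgebra : StarSubalgebra ℂ (H →L[ℂ] H) :=
  StarSubalgebra.centralizer ℂ (StarSubalgebra.centralizer ℂ (Set.range U.op) : Set (H →L[ℂ] H))

theorem mem_translationAlgebra {T : H →L[ℂ] H}
    (hT : ∀ B : H →L[ℂ] H, (∀ x, U.op x * B = B * U.op x) → T * B = B * T) :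
    T ∈ U.translationAlgebra := by
  have key : ∀ B ∈ StarSubalgebra.centralizer ℂ (Set.range U.op), B * T = T * B := fun B hB =>
    (hT B fun x => ((StarSubalgebra.mem_centralizer_iff ℂ).1 hB _ ⟨x, rfl⟩).1).symm
  exact (StarSubalgebra.mem_centralizer_iff ℂ).2 fun B hB => ⟨key B hB, key _ (star_mem hB)⟩

theorem op_mem_translationAlgebra (x : Minkowski) : U.op x ∈ U.translationAlgebra :=
  U.mem_translationAlgebra fun _ hB => hB x

instance isClosed_translationAlgebra : IsClosed (U.translationAlgebra : Set (H →L[ℂ] H)) := by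
  rw [translationAlgebra, StarSubalgebra.coe_centralizer]
  exact Set.isClosed_centralizer _

theorem translationAlgebra_comm (S T : U.translationAlgebra) : S * T = T * S := by
  have hU : (U.translationAlgebra : Set (H →L[ℂ] H)) = _ :=
    StarSubalgebra.coe_centralizer_centralizer ℂ (Set.range U.op)
  have hS : (S : H →L[ℂ] H) ∈ (U.translationAlgebra : Set (H →L[ℂ] H)) := S.2
  have hT : (T : H →L[ℂ] H) ∈ (U.translationAlgebra : Set (H →L[ℂ] H)) := T.2
  rw [hU] at hS hT
  refine Subtype.ext (Set.centralizer_centralizer_comm_of_comm ?_ _ hS _ hT)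
  have hstar : star (Set.range U.op) ⊆ Set.range U.op := by
    rintro _ ⟨x, hx⟩
    exact ⟨-x, by rw [← star_op, hx, star_star]⟩
  rw [Set.union_eq_self_of_subset_right hstar]
  rintro _ ⟨x, rfl⟩ _ ⟨y, rfl⟩
  rw [← op_add, ← op_add, add_comm]

/-- Characters of the translation algebra separate its elements. -/
theorem exists_character {S : U.translationAlgebra} (hS : S ≠ 0) :
    ∃ χ : U.translationAlgebra →L[ℂ] ℂ, (∀ a b, χ (a * b) = χ a * χ b) ∧ χ 1 = 1 ∧
      (∀ a, ‖χ a‖ ≤ ‖a‖) ∧ χ S ≠ 0 := by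
  have : Nontrivial U.translationAlgebra := ⟨S, 0, hS⟩
  let _ : CommCStarAlgebra U.translationAlgebra :=
    { (inferInstance : CStarAlgebra U.translationAlgebra) with
      mul_comm := U.translationAlgebra_comm }
  by_contra! h
  apply hS
  apply (gelfandTransform_isometry U.translationAlgebra).injective
  rw [map_zero]
  ext χ
  refine h (WeakDual.CharacterSpace.toCLM χ) (fun a b => map_mul χ a b) (map_one χ) fun a => ?_
  exact AlgHom.norm_apply_le_self (WeakDual.CharacterSpace.toAlgHom χ) a

/-- `U(x)` as an element of the translation algebra. -/
def algOp (x : Minkowski) : U.translationAlgebra := ⟨U.op x, U.op_mem_translationAlgebra x⟩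

theorem algOp_add (x y : Minkowski) : U.algOp (x + y) = U.algOp x * U.algOp y :=
  Subtype.ext (U.op_add x y)

theorem algOp_zero : U.algOp 0 = 1 := Subtype.ext U.op_zero

theorem norm_algOp_le (x : Minkowski) : ‖U.algOp x‖ ≤ 1 := U.norm_op_le x

/-- On elements on which the translations act norm continuously, characters commute with
smearing. -/
theorem character_smearOp {α : Type*} [TopologicalSpace α] [SecondCountableTopology α]
    [MeasurableSpace α] [OpensMeasurableSpace α] {μ : Measure α} {f : α → ℂ}
    (hf : Integrable f μ) {γ : α → Minkowski} (hγ : Continuous γ) {S T : U.translationAlgebra}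
    (hT : ∀ v, (T : H →L[ℂ] H) v = ∫ t, f t • U.op (γ t) v ∂μ)
    (hS : Continuous fun x => U.algOp x * S)
    (χ : U.translationAlgebra →L[ℂ] ℂ) (hχ : ∀ a b, χ (a * b) = χ a * χ b) (hχS : χ S ≠ 0) :
    χ T = ∫ t, f t * χ (U.algOp (γ t)) ∂μ := by
  -- `U` is only strongly continuous; multiplying by `S` makes the integral converge in norm, so
  -- that `χ` can be pulled inside.
  have hi : Integrable (fun t => f t • (U.algOp (γ t) * S)) μ :=
    hf.smul_bdd ‖S‖ (hS.comp hγ).aestronglyMeasurable (ae_of_all _ fun t =>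
      (norm_mul_le _ _).trans (mul_le_of_le_one_left (norm_nonneg _) (U.norm_algOp_le _)))
  have hTS : ∫ t, f t • (U.algOp (γ t) * S) ∂μ = T * S := by
    apply Subtype.ext
    ext v
    let ev : U.translationAlgebra →L[ℂ] H :=
      (ContinuousLinearMap.apply ℂ H v).comp U.translationAlgebra.toSubalgebra.toSubmodule.subtypeL
    have h1 := ev.integral_comp_comm hi
    calc _ = ∫ t, ev (f t • (U.algOp (γ t) * S)) ∂μ := h1.symm
      _ = (T : H →L[ℂ] H) ((S : H →L[ℂ] H) v) := (hT _).symm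
  have h2 := χ.integral_comp_comm hi
  rw [hTS, hχ] at h2
  have h3 : ∀ t, χ (f t • (U.algOp (γ t) * S)) = f t * χ (U.algOp (γ t)) * χ S := fun t => by
    rw [map_smul, hχ, smul_eq_mul, mul_assoc]
  simp_rw [h3] at h2
  rw [integral_mul_const] at h2
  exact (mul_right_cancel₀ hχS h2).symm

/-- A smeared translation operator whose symbol vanishes on the spectrum annihilates the elements
of the translation algebra on which the translations act norm continuously. -/
theorem smearOp_mul_eq_zero (hU : U.SpectrumCondition) {n : Minkowski}
    (hn : ∀ p ∈ forwardCone, 0 ≤ lorentz p n) {f : ℝ → ℂ} (hf : Integrable f)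
    (hf0 : ∀ s : ℝ, 0 ≤ s → ∫ t : ℝ, f t * exp (I * (s * t : ℝ)) = 0)
    {S T : U.translationAlgebra}
    (hT : ∀ v, (T : H →L[ℂ] H) v = ∫ t : ℝ, f t • U.op (t • n) v)
    (hS : Continuous fun x => U.algOp x * S) : T * S = 0 := by
  by_contra hTS
  obtain ⟨χ, hχ, hχ1, hχb, hχ0⟩ := U.exists_character hTS
  rw [hχ] at hχ0
  have hχT := left_ne_zero_of_mul hχ0
  have hχS := right_ne_zero_of_mul hχ0
  -- A character need not be continuous along `x ↦ U(x)`; it is here because `χ (U(x)) = χ (U(x) S)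
  -- / χ S`.
  obtain ⟨p, hp⟩ := exists_eq_planeWave (χ := fun x => χ (U.algOp x))
    (by
      have h1 : Continuous fun x => χ (U.algOp x * S) / χ S := (χ.continuous.comp hS).div_const _
      refine h1.congr fun x => ?_
      rw [hχ, mul_div_cancel_right₀ _ hχS])
    (by simp only [algOp_zero, hχ1]) (fun x y => by simp only [algOp_add, hχ])
    (fun x => (hχb _).trans (U.norm_algOp_le x))
  -- If `U(φ) = 0`, then `0 = χ(U(φ))` is the Fourier transform of `φ` at `p`.
  have hpsp : p ∈ U.sp := by
    intro φ hφ
    have h1 := U.character_smearOp (μ := volume) (f := φ) φ.integrable continuous_id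
      (T := 0) (fun v => (hφ v).symm) hS χ hχ hχS
    rw [map_zero] at h1
    simp only [id] at h1
    rw [lorentzFourier, h1]
    simp only [hp]
  apply hχT
  rw [U.character_smearOp hf (γ := fun t : ℝ => t • n) (by fun_prop) hT hS χ hχ hχS]
  simp only [hp, lorentz_smul_right]
  exact hf0 _ (hn p (hU hpsp))

/-- Smearing with a bump function gives norm continuity, because `‖U(a) S - U(b) S‖` is at most the
`L¹` distance between the translates of `ψ` by `a` and `b`. -/
theorem exists_regularizer {ψ : Minkowski → ℝ} (hψ : Continuous ψ) (hs : HasCompactSupport ψ) :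
    ∃ S : U.translationAlgebra, (∀ v, (S : H →L[ℂ] H) v = ∫ x, (ψ x : ℂ) • U.op x v) ∧
      Continuous fun x => U.algOp x * S := by
  have hi : Integrable fun x => (ψ x : ℂ) := (hψ.integrable_of_hasCompactSupport hs).ofReal
  obtain ⟨T, hT⟩ := U.exists_smearOp hi continuous_id
  refine ⟨⟨T, U.mem_translationAlgebra fun B hB => U.commute_smearOp hi continuous_id hT hB⟩,
    hT, ?_⟩
  have hsh : ∀ a v, U.op a (T v) = ∫ x, (ψ (x - a) : ℂ) • U.op x v := by
    intro a v
    rw [show T v = ∫ x, (ψ x : ℂ) • U.op x v from hT v, ← (U.op a).integral_comp_comm (U.integrable_smul_op_self hi v),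
      ← integral_add_left_eq_self (fun x => (ψ (x - a) : ℂ) • U.op x v) a]
    congr 1
    ext x
    rw [map_smul, add_sub_cancel_left, op_add_apply]
  have hia : ∀ a, Integrable fun x => (ψ (x - a) : ℂ) := fun a => hi.comp_sub_right a
  have hcont : ∀ b, Continuous fun a => ∫ x, ‖(ψ (x - a) : ℂ) - ψ (x - b)‖ := by
    intro b
    rw [continuous_iff_continuousAt]
    intro c
    let K : Set Minkowski := ((fun q : Minkowski × Minkowski => q.1 + q.2) ''
      (tsupport ψ ×ˢ Metric.closedBall c 1)) ∪ ((fun q => q + b) '' tsupport ψ)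
    have hK : IsCompact K := ((hs.isCompact.prod (isCompact_closedBall c 1)).image
      (by fun_prop)).union (hs.isCompact.image (by fun_prop))
    refine ContinuousOn.continuousAt (s := Metric.closedBall c 1) ?_
      (Metric.closedBall_mem_nhds c one_pos)
    refine continuousOn_integral_of_compact_support hK (Continuous.continuousOn ?_) ?_
    · simp only [Function.uncurry_def]
      fun_prop
    · intro a x ha hx
      have h1 : ψ (x - a) = 0 := by
        by_contra h
        exact hx (Or.inl ⟨(x - a, a), ⟨subset_tsupport _ h, ha⟩, sub_add_cancel _ _⟩)
      have h2 : ψ (x - b) = 0 := by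
        by_contra h
        exact hx (Or.inr ⟨x - b, subset_tsupport _ h, sub_add_cancel _ _⟩)
      simp [h1, h2]
  have hle : ∀ a b, ‖U.op a * T - U.op b * T‖ ≤ ∫ x, ‖(ψ (x - a) : ℂ) - ψ (x - b)‖ := by
    intro a b
    refine ContinuousLinearMap.opNorm_le_bound _ (integral_nonneg fun _ => norm_nonneg _) fun v => ?_
    change ‖U.op a (T v) - U.op b (T v)‖ ≤ _
    rw [hsh, hsh, ← integral_sub (U.integrable_smul_op_self (hia a) v)
      (U.integrable_smul_op_self (hia b) v)]
    refine (norm_integral_le_integral_norm _).trans (le_of_eq ?_)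
    rw [← integral_mul_const]
    congr 1
    ext x
    rw [← sub_smul, norm_smul, norm_op_apply]
  refine Continuous.subtype_mk ?_ _
  rw [continuous_iff_continuousAt]
  intro b
  rw [ContinuousAt, tendsto_iff_norm_sub_tendsto_zero]
  refine squeeze_zero (fun _ => norm_nonneg _) (fun a => hle a b) ?_
  simpa using (hcont b).tendsto b

/-- The spectrum condition, integrated along a half-line: the one-parameter group `t ↦ U(t n)` has
nonnegative spectrum if `p · n ≥ 0` on the forward cone. -/
theorem integral_smul_op_eq_zero (hU : U.SpectrumCondition) {n : Minkowski}
    (hn : ∀ p ∈ forwardCone, 0 ≤ lorentz p n) {f : ℝ → ℂ} (hf : Integrable f)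
    (hf0 : ∀ s : ℝ, 0 ≤ s → ∫ t : ℝ, f t * exp (I * (s * t : ℝ)) = 0) (v : H) :
    ∫ t : ℝ, f t • U.op (t • n) v = 0 := by
  have hγ : Continuous fun t : ℝ => t • n := by fun_prop
  obtain ⟨T, hT⟩ := U.exists_smearOp hf hγ
  have hTm : T ∈ U.translationAlgebra :=
    U.mem_translationAlgebra fun B hB => U.commute_smearOp hf hγ hT hB
  rw [← hT]
  -- `T` kills every regularized vector, so `x ↦ T U(x) v` vanishes as a distribution; being
  -- continuous, it vanishes at `x = 0`.
  have hc : Continuous fun x => T (U.op x v) := T.continuous.comp (U.continuous_op_apply v)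
  have hae : ∀ᵐ x : Minkowski, T (U.op x v) = 0 := by
    refine ae_eq_zero_of_integral_contDiff_smul_eq_zero hc.locallyIntegrable fun ψ hψ hs => ?_
    obtain ⟨S, hS, hSc⟩ := U.exists_regularizer hψ.continuous hs
    have hi : Integrable fun x => (ψ x : ℂ) :=
      (hψ.continuous.integrable_of_hasCompactSupport hs).ofReal
    have h0 := congrArg (fun R : U.translationAlgebra => (R : H →L[ℂ] H) v)
      (U.smearOp_mul_eq_zero hU hn hf hf0 (T := ⟨T, hTm⟩) hT hSc)
    change T ((S : H →L[ℂ] H) v) = 0 at h0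
    rw [hS, ← T.integral_comp_comm (U.integrable_smul_op_self hi v)] at h0
    rw [← h0]
    congr 1
    ext x
    rw [map_smul]
    exact (Complex.coe_smul _ _).symm
  have := (hc.ae_eq_iff_eq volume continuous_const).1 hae
  simpa [op_zero] using congrFun this 0

theorem oneSided_inner (hU : U.SpectrumCondition) {n : Minkowski}
    (hn : ∀ p ∈ forwardCone, 0 ≤ lorentz p n) (u v : H) :
    OneSided fun t => inner ℂ u (U.op (t • n) v) := by
  intro f hf hf0
  have h1 := (innerSL ℂ u).integral_comp_comm
    (U.integrable_smul_op hf (γ := fun t : ℝ => t • n) (by fun_prop) v)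
  rw [U.integral_smul_op_eq_zero hU hn hf hf0, map_zero] at h1
  rw [← h1]
  congr 1
  ext t
  rw [map_smul]
  rfl

end TranslationRep

end Rep

/-! ### Lightlike directions and vacuum vectors -/

theorem lorentz_nonneg_of_mem_forwardCone {p n : Minkowski} (hp : p ∈ forwardCone)
    (hn : n ∈ forwardCone) : 0 ≤ lorentz p n := by
  obtain ⟨hp0, hp⟩ := hp
  obtain ⟨hn0, hn⟩ := hn
  simp only [lorentz] at *
  have h1 : (p 1 * n 1 + p 2 * n 2 + p 3 * n 3) ^ 2 ≤
      (p 1 ^ 2 + p 2 ^ 2 + p 3 ^ 2) * (n 1 ^ 2 + n 2 ^ 2 + n 3 ^ 2) := by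
    nlinarith [sq_nonneg (p 1 * n 2 - p 2 * n 1), sq_nonneg (p 1 * n 3 - p 3 * n 1),
      sq_nonneg (p 2 * n 3 - p 3 * n 2)]
  have h2 : (p 1 ^ 2 + p 2 ^ 2 + p 3 ^ 2) * (n 1 ^ 2 + n 2 ^ 2 + n 3 ^ 2) ≤ p 0 ^ 2 * n 0 ^ 2 := by
    apply mul_le_mul <;> first | positivity | nlinarith
  have h3 := abs_le_of_sq_le_sq' (h1.trans (h2.trans_eq (mul_pow _ _ 2).symm))
    (mul_nonneg hp0 hn0)
  linarith [h3.2]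

theorem OneSided.sub {g h : ℝ → ℂ} (hg : OneSided g) (hh : OneSided h) (hgc : Continuous g)
    (hhc : Continuous h) {M N : ℝ} (hM : ∀ t, ‖g t‖ ≤ M) (hN : ∀ t, ‖h t‖ ≤ N) :
    OneSided fun t => g t - h t := by
  intro f hf hf0
  simp only [mul_sub]
  rw [integral_sub (integrable_bdd_mul hf hgc hM) (integrable_bdd_mul hf hhc hN), hg f hf hf0,
    hh f hf hf0, sub_zero]

section Rep

variable {H : Type*} [NormedAddCommGroup H] [InnerProductSpace ℂ H] [CompleteSpace H]

namespace TranslationRep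

variable (U : TranslationRep H)

theorem norm_inner_op_le (u v : H) (x : Minkowski) : ‖inner ℂ u (U.op x v)‖ ≤ ‖u‖ * ‖v‖ :=
  (norm_inner_le_norm _ _).trans_eq (by rw [norm_op_apply])

theorem continuous_inner_op (u v : H) : Continuous fun x => inner ℂ u (U.op x v) :=
  continuous_const.inner (U.continuous_op_apply v)

/-- A vector fixed by all lightlike translations is fixed by all translations. -/
theorem invariant_of_lightlike {v : H}
    (hv : ∀ n : Minkowski, n 0 = 1 → lorentz n n = 0 → ∀ t : ℝ, U.op (t • n) v = v) :
    U.Invariant v := by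
  intro x
  -- Four lightlike vectors with time component 1 form a basis.
  have hx : x = ((x 0 - x 2 - x 3 + x 1) / 2) • (!₂[1, 1, 0, 0] : Minkowski) +
      (((x 0 - x 2 - x 3 - x 1) / 2) • (!₂[1, -1, 0, 0] : Minkowski) +
      (x 2 • (!₂[1, 0, 1, 0] : Minkowski) + x 3 • (!₂[1, 0, 0, 1] : Minkowski))) := by
    ext i
    fin_cases i <;> simp <;> ring
  rw [hx, op_add_apply, op_add_apply, op_add_apply, hv, hv, hv, hv] <;> simp [lorentz]

/-- Take the vacuum expectation of the commutation relation; invariance of `Ω` removes the outer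
translations. -/
theorem inner_eq_of_commute {Ω : H} (hΩ : U.Invariant Ω) {T : H →L[ℂ] H} {y : Minkowski}
    (hT : T * (U.op y * star T * star (U.op y)) = (U.op y * star T * star (U.op y)) * T) :
    inner ℂ (T Ω) (U.op (-y) (T Ω)) = inner ℂ (star T Ω) (U.op y (star T Ω)) := by
  have h1 := congrArg (fun S : H →L[ℂ] H => inner ℂ Ω (S Ω)) hT
  rw [star_op] at h1
  change inner ℂ Ω (T (U.op y (star T (U.op (-y) Ω)))) =
    inner ℂ Ω (U.op y (star T (U.op (-y) (T Ω)))) at h1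
  rw [hΩ, U.inner_op_right, hΩ] at h1
  simp only [ContinuousLinearMap.star_eq_adjoint] at h1 ⊢
  rw [ContinuousLinearMap.adjoint_inner_right, ← ContinuousLinearMap.adjoint_inner_left] at h1
  exact h1.symm

/-- If `T` commutes with the adjoints of its spacelike translates then `T Ω` is translation
invariant. -/
theorem invariant_of_commute (hU : U.SpectrumCondition) {Ω : H} (hΩ : U.Invariant Ω)
    {T : H →L[ℂ] H} (hT : ∀ y, lorentz y y < 0 →
      T * (U.op y * star T * star (U.op y)) = (U.op y * star T * star (U.op y)) * T) :
    U.Invariant (T Ω) := by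
  refine U.invariant_of_lightlike fun n hn0 hn t => ?_
  set a := T Ω
  set b := star T Ω
  have hcone : ∀ p ∈ forwardCone, 0 ≤ lorentz p n := fun p hp =>
    lorentz_nonneg_of_mem_forwardCone hp ⟨by rw [hn0]; exact zero_le_one, hn.ge⟩
  have hca : Continuous fun x => inner ℂ a (U.op (-x) a) :=
    (U.continuous_inner_op a a).comp continuous_neg
  have hcb := U.continuous_inner_op b b
  -- Shortening the time component of `n` by `ε` makes `s n` spacelike; then `ε → 0`. The point `s =
  -- 0` is recovered by density.
  have h1 : ∀ s : ℝ, s ≠ 0 → inner ℂ a (U.op (-(s • n)) a) = inner ℂ b (U.op (s • n) b) := by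
    intro s hs
    have hl : Continuous fun ε : ℝ => s • (n - ε • EuclideanSpace.single 0 (1 : ℝ)) := by fun_prop
    have la := (hca.comp hl).tendsto 0 |>.mono_left (nhdsWithin_le_nhds (s := Set.Ioi 0))
    have lb := (hcb.comp hl).tendsto 0 |>.mono_left (nhdsWithin_le_nhds (s := Set.Ioi 0))
    have le := la.congr' (f₂ := _) (by
      filter_upwards [Ioo_mem_nhdsGT (zero_lt_one' ℝ)] with ε hε
      refine U.inner_eq_of_commute hΩ (hT _ ?_)
      have : 0 < s ^ 2 := by positivity
      simp only [lorentz] at hn ⊢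
      simp [hn0] at hn ⊢
      nlinarith [mul_pos this (mul_pos hε.1 (sub_pos.2 hε.2)), mul_pos this hε.1])
    simpa using tendsto_nhds_unique le lb
  have h2 : ∀ s : ℝ, inner ℂ a (U.op (-(s • n)) a) = inner ℂ b (U.op (s • n) b) := by
    have hl : Continuous fun s : ℝ => s • n := by fun_prop
    exact congrFun ((hca.comp hl).ext_on (dense_compl_singleton (0 : ℝ)) (hcb.comp hl)
      fun s hs => h1 s hs)
  -- The reflection of the `a`-correlation is the `b`-correlation, so both are one-sided. The
  -- resulting equality in Cauchy–Schwarz gives `U(t n) a = a`.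
  have h3 : inner ℂ a (U.op (t • n) a) = inner ℂ a a := by
    have := (U.oneSided_inner hU hcone a a).eq_const (by
      have := U.oneSided_inner hU hcone b b
      simp_rw [← h2] at this
      simpa only [neg_smul] using this)
      ((U.continuous_inner_op a a).comp (by fun_prop)) (fun s => U.norm_inner_op_le a a _) t
    simpa [op_zero] using this
  rw [← sub_eq_zero, ← inner_self_eq_zero (𝕜 := ℂ), inner_sub_left, inner_sub_right,
    inner_sub_right, ← inner_conj_symm _ a, h3, inner_self_eq_norm_sq_to_K,
    inner_self_eq_norm_sq_to_K, norm_op_apply]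
  simp

/-- Wightman's theorem on fields of bounded operators at points. -/
theorem exists_apply_eq_smul (hU : U.SpectrumCondition) {A : Minkowski → (H →L[ℂ] H)} {Ω : H}
    (hA : ∀ x y : Minkowski, SpacelikeSep x y → A x * star (A y) = star (A y) * A x)
    (hUA : ∀ x y : Minkowski, U.op x * A y * star (U.op x) = A (y - x))
    (hΩ : U.Invariant Ω) (huniq : ∀ v : H, U.Invariant v → ∃ c : ℂ, v = c • Ω) :
    ∃ c : ℂ, ∀ x : Minkowski, A x Ω = c • Ω := by
  obtain ⟨c, hc⟩ := huniq _ (U.invariant_of_commute hU hΩ (T := A 0) fun y hy => by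
    have h1 : U.op y * star (A 0) * star (U.op y) = star (A (0 - y)) := by
      rw [← hUA y 0]
      simp [mul_assoc]
    rw [h1]
    exact hA _ _ (by simpa [SpacelikeSep] using hy))
  refine ⟨c, fun x => ?_⟩
  have h1 := hUA (-x) 0
  rw [zero_sub, neg_neg, star_op] at h1
  rw [← h1]
  change U.op (-x) (A 0 (U.op (- -x) Ω)) = _
  rw [hΩ, hc, map_smul, hΩ]

/-- If `A U(x) v = U(x) w` on an interval of a line in a forward lightlike direction, then on the
whole line. -/
theorem eq_on_line (hU : U.SpectrumCondition) {n : Minkowski} (hn : n ∈ forwardCone)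
    {A : H →L[ℂ] H} {v w : H} {y : Minkowski} {a b : ℝ} (hab : a < b)
    (h : ∀ t ∈ Set.Ioo a b, A (U.op (t • n + y) v) = U.op (t • n + y) w) (t : ℝ) :
    A (U.op (t • n + y) v) = U.op (t • n + y) w := by
  have hcone : ∀ p ∈ forwardCone, 0 ≤ lorentz p n := fun p hp =>
    lorentz_nonneg_of_mem_forwardCone hp hn
  refine ext_inner_left ℂ fun u => ?_
  have hl : Continuous fun s : ℝ => s • n := by fun_prop
  have c1 := (U.continuous_inner_op (star A u) (U.op y v)).comp hl
  have c2 := (U.continuous_inner_op u (U.op y w)).comp hl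
  have b1 := fun s : ℝ => U.norm_inner_op_le (star A u) (U.op y v) (s • n)
  have b2 := fun s : ℝ => U.norm_inner_op_le u (U.op y w) (s • n)
  have e1 : ∀ s : ℝ, inner ℂ (star A u) (U.op (s • n) (U.op y v)) =
      inner ℂ u (A (U.op (s • n + y) v)) := fun s => by
    rw [ContinuousLinearMap.star_eq_adjoint, ContinuousLinearMap.adjoint_inner_left, op_add_apply]
  have key := ((U.oneSided_inner hU hcone (star A u) (U.op y v)).sub
    (U.oneSided_inner hU hcone u (U.op y w)) c1 c2 b1 b2).eq_zero (c1.sub c2)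
    (fun s => (norm_sub_le _ _).trans (add_le_add (b1 s) (b2 s))) hab (fun s hs => by
      rw [e1, h s hs, op_add_apply, sub_self]) t
  rwa [e1, ← op_add_apply, sub_eq_zero] at key

/-- If `A U(x) v = U(x) w` for all `x` in a far spacelike region, then `A v = w`. -/
theorem eq_of_eq_far (hU : U.SpectrumCondition) {A : H →L[ℂ] H} {v w : H} {L : ℝ}
    (h : ∀ x : Minkowski, |x 0| ≤ 1 → x 1 ≤ -L → A (U.op x v) = U.op x w) : A v = w := by
  have hp : (!₂[1, 1, 0, 0] : Minkowski) ∈ forwardCone := by simp [forwardCone, lorentz]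
  have hm : (!₂[1, -1, 0, 0] : Minkowski) ∈ forwardCone := by simp [forwardCone, lorentz]
  -- In these light-cone coordinates `x 0 = α + β` and `x 1 = α - β`. For `|α + β| < 1` one has `x 1
  -- < 1 - 2 β ≤ -L`, so an interval of each such line lies in the far region.
  have h1 : ∀ β : ℝ, (L + 1) / 2 ≤ β → ∀ α : ℝ,
      A (U.op (α • !₂[1, 1, 0, 0] + β • !₂[1, -1, 0, 0]) v) =
        U.op (α • !₂[1, 1, 0, 0] + β • !₂[1, -1, 0, 0]) w := by
    intro β hβ
    refine U.eq_on_line hU hp (a := -β - 1) (b := -β + 1) (by linarith) fun α hα => h _ ?_ ?_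
    · simp
      exact abs_le.2 ⟨by linarith [hα.1], by linarith [hα.2]⟩
    · simp
      linarith [hα.2]
  -- Now `α = 0` and `β` is continued from beyond `(L + 1) / 2` to zero.
  have h2 := U.eq_on_line hU hm (A := A) (v := v) (w := w) (y := 0)
    (lt_add_one ((L + 1) / 2)) (fun β hβ => by simpa using h1 β hβ.1.le 0) 0
  simpa [op_zero] using h2

end TranslationRep

end Rep

/-! ### Geometry of double cones -/

theorem mem_future_iff {x z : Minkowski} : z ∈ future x ↔ 0 < z 0 - x 0 ∧
    (z 1 - x 1) ^ 2 + (z 2 - x 2) ^ 2 + (z 3 - x 3) ^ 2 < (z 0 - x 0) ^ 2 := by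
  simp only [future, lorentz, Set.mem_ofPred_eq, PiLp.sub_apply]
  constructor <;> rintro ⟨h1, h2⟩ <;> exact ⟨h1, by linarith⟩

theorem abs_sub_lt_of_mem_future {x z : Minkowski} (h : z ∈ future x) (i : Fin 4) :
    |z i - x i| ≤ z 0 - x 0 := by
  obtain ⟨h0, h1⟩ := mem_future_iff.1 h
  fin_cases i
  · exact (abs_of_pos h0).le
  all_goals
    refine abs_le_of_sq_le_sq ?_ h0.le
    simp only [Fin.mk_one, Fin.reduceFinMk]
    nlinarith [sq_nonneg (z 1 - x 1), sq_nonneg (z 2 - x 2), sq_nonneg (z 3 - x 3)]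

theorem IsDoubleCone.bounded {O : Set Minkowski} (hO : IsDoubleCone O) :
    ∃ R : ℝ, 0 < R ∧ ∀ z ∈ O, ∀ i, |z i| ≤ R := by
  obtain ⟨x, y, hxy, rfl⟩ := hO
  refine ⟨y 0 - x 0 + ∑ i, |x i|, add_pos_of_pos_of_nonneg (mem_future_iff.1 hxy).1
    (Finset.sum_nonneg fun _ _ => abs_nonneg _), fun z hz i => ?_⟩
  have h1 := abs_sub_lt_of_mem_future hz.1 i
  have h2 := (mem_future_iff.1 hz.2).1
  have h3 := Finset.single_le_sum (f := fun i => |x i|) (fun _ _ => abs_nonneg _)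
    (Finset.mem_univ i)
  have h4 := abs_add_le (z i - x i) (x i)
  rw [sub_add_cancel] at h4
  simp only at h3
  linarith

/-- The double cone with centre `c` and half-height `r`. -/
def centeredCone (c : Minkowski) (r : ℝ) : Set Minkowski :=
  future (c - r • EuclideanSpace.single 0 (1 : ℝ)) ∩ past (c + r • EuclideanSpace.single 0 (1 : ℝ))

theorem mem_centeredCone_iff {c z : Minkowski} {r : ℝ} : z ∈ centeredCone c r ↔
    (0 < r + (z 0 - c 0) ∧
      (z 1 - c 1) ^ 2 + (z 2 - c 2) ^ 2 + (z 3 - c 3) ^ 2 < (r + (z 0 - c 0)) ^ 2) ∧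
    (0 < r - (z 0 - c 0) ∧
      (z 1 - c 1) ^ 2 + (z 2 - c 2) ^ 2 + (z 3 - c 3) ^ 2 < (r - (z 0 - c 0)) ^ 2) := by
  simp only [centeredCone, past, Set.mem_inter_iff, Set.mem_ofPred_eq, mem_future_iff]
  have e1 : z 0 - (c 0 - r) = r + (z 0 - c 0) := by ring
  have e2 : c 0 + r - z 0 = r - (z 0 - c 0) := by ring
  simp [e1, e2, sub_sq_comm (c _)]

theorem isDoubleCone_centeredCone (c : Minkowski) {r : ℝ} (hr : 0 < r) :
    IsDoubleCone (centeredCone c r) := by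
  refine ⟨_, _, mem_future_iff.2 ?_, rfl⟩
  simp
  constructor <;> [linarith; positivity]

theorem self_mem_centeredCone (c : Minkowski) {r : ℝ} (hr : 0 < r) : c ∈ centeredCone c r :=
  mem_centeredCone_iff.2 (by simp [hr])

theorem abs_sub_le_of_mem_centeredCone {c z : Minkowski} {r : ℝ} (hz : z ∈ centeredCone c r)
    (i : Fin 4) : |z i - c i| ≤ 2 * r := by
  obtain ⟨⟨h0, h1⟩, h2, -⟩ := mem_centeredCone_iff.1 hz
  fin_cases i
  · exact abs_le.2 ⟨by simp only [Fin.zero_eta]; linarith, by simp only [Fin.zero_eta]; linarith⟩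
  all_goals
    refine (abs_le_of_sq_le_sq ?_ h0.le).trans (by linarith)
    simp only [Fin.mk_one, Fin.reduceFinMk]
    nlinarith [sq_nonneg (z 1 - c 1), sq_nonneg (z 2 - c 2), sq_nonneg (z 3 - c 3)]

/-- Any two double cones are contained in a third. -/
theorem DoubleCone.directed (O₁ O₂ : DoubleCone) : ∃ O : DoubleCone, O₁.1 ⊆ O.1 ∧ O₂.1 ⊆ O.1 := by
  obtain ⟨R₁, h1, hb1⟩ := O₁.2.bounded
  obtain ⟨R₂, h2, hb2⟩ := O₂.2.bounded
  have key : ∀ z : Minkowski, (∀ i, |z i| ≤ R₁ + R₂) → z ∈ centeredCone 0 (3 * (R₁ + R₂)) := by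
    intro z hz
    have hR : 0 < R₁ + R₂ := by linarith
    have hsq : ∀ i, z i ^ 2 ≤ (R₁ + R₂) ^ 2 := fun i => sq_le_sq' (abs_le.1 (hz i)).1 (abs_le.1 (hz i)).2
    have h0 := abs_le.1 (hz 0)
    rw [mem_centeredCone_iff]
    simp only [PiLp.zero_apply, sub_zero]
    -- Three squares give `3 < 2²`, while half-height `3 (R₁ + R₂)` leaves at least `2 (R₁ + R₂)` in
    -- time on either side.
    have hs : z 1 ^ 2 + z 2 ^ 2 + z 3 ^ 2 < (2 * (R₁ + R₂)) ^ 2 := by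
      nlinarith [hsq 1, hsq 2, hsq 3, pow_pos hR 2]
    refine ⟨⟨by linarith, hs.trans_le ?_⟩, by linarith, hs.trans_le ?_⟩ <;>
      exact pow_le_pow_left₀ (by linarith) (by linarith) 2
  exact ⟨⟨_, isDoubleCone_centeredCone 0 (by positivity)⟩,
    fun z hz => key z fun i => (hb1 z hz i).trans (by linarith),
    fun z hz => key z fun i => (hb2 z hz i).trans (by linarith)⟩

/-- A small double cone around a point is spacelike separated from its translate by a given
spacelike vector. -/
theorem exists_spacelikeSep_translate (x : Minkowski) {y : Minkowski} (hy : lorentz y y < 0) :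
    ∃ O : DoubleCone, x ∈ O.1 ∧ O.SpacelikeSep (O.translate y) := by
  let q : (Fin 4 → ℝ) → ℝ := fun d =>
    (d 0 - y 0) ^ 2 - (d 1 - y 1) ^ 2 - (d 2 - y 2) ^ 2 - (d 3 - y 3) ^ 2
  have hq : Continuous q := by fun_prop
  have h0 : q 0 < 0 := by
    simp only [lorentz] at hy
    simp [q]
    linarith
  obtain ⟨δ, hδ, hball⟩ := Metric.isOpen_iff.1 (isOpen_lt hq continuous_const) 0 h0
  refine ⟨⟨_, isDoubleCone_centeredCone x (r := δ / 8) (by positivity)⟩,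
    self_mem_centeredCone x (by positivity), fun z hz z' hz' => ?_⟩
  -- Each of the two terms is at most `2 · δ / 8`. Their difference `d` satisfies `z - z' = d - y`,
  -- so `q d` is the Lorentz square of `z - z'`.
  have h1 : (fun i => (z i - x i) - ((z' - y) i - x i)) ∈ Metric.ball (0 : Fin 4 → ℝ) δ := by
    rw [Metric.mem_ball, dist_zero_right, pi_norm_lt_iff hδ]
    intro i
    have e1 := abs_sub_le_of_mem_centeredCone hz i
    have e2 := abs_sub_le_of_mem_centeredCone (z := z' - y) hz' i
    refine (norm_sub_le _ _).trans_lt ?_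
    rw [Real.norm_eq_abs, Real.norm_eq_abs]
    linarith
  have h2 : q (fun i => (z i - x i) - ((z' - y) i - x i)) < 0 := hball h1
  simp only [q, PiLp.sub_apply] at h2
  simp only [AQFT.SpacelikeSep, lorentz, PiLp.sub_apply]
  ring_nf at h2 ⊢
  exact h2

/-- Far spacelike translates of a double cone around a point are spacelike separated from a given
double cone. -/
theorem exists_far_spacelikeSep (x : Minkowski) (O : DoubleCone) :
    ∃ (O' : DoubleCone) (L : ℝ), x ∈ O'.1 ∧ ∀ y : Minkowski, |y 0| ≤ 1 → L ≤ y 1 →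
      (O'.translate y).SpacelikeSep O := by
  obtain ⟨R, hR, hb⟩ := O.2.bounded
  have hO' := isDoubleCone_centeredCone x one_pos
  obtain ⟨R', hR', hb'⟩ := hO'.bounded
  -- Time differences are at most `R + R' + 1`; this `L` keeps differences in coordinate `1` at
  -- least `R + R' + 2`.
  refine ⟨⟨_, hO'⟩, 2 * (R + R') + 2, self_mem_centeredCone x one_pos,
    fun y h0 h1 z hz z' hz' => ?_⟩
  have a0 := abs_le.1 (hb' (z - y) hz 0)
  have a1 := abs_le.1 (hb' (z - y) hz 1)
  have b0 := abs_le.1 (hb z' hz' 0)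
  have b1 := abs_le.1 (hb z' hz' 1)
  have c0 := abs_le.1 h0
  simp only [PiLp.sub_apply] at a0 a1
  simp only [AQFT.SpacelikeSep, lorentz, PiLp.sub_apply]
  have h2 : (z 0 - z' 0) ^ 2 ≤ (R + R' + 1) ^ 2 :=
    sq_le_sq' (by linarith [a0.1, b0.2, c0.1]) (by linarith [a0.2, b0.1, c0.2])
  have h3 : (R + R' + 2) ^ 2 ≤ (z 1 - z' 1) ^ 2 :=
    pow_le_pow_left₀ (by linarith) (by linarith [a1.1, b1.2]) 2
  nlinarith [sq_nonneg (z 2 - z' 2), sq_nonneg (z 3 - z' 3)]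

/-! ### Irreducible nets and the algebra at a point -/

section Rep

variable {H : Type*} [NormedAddCommGroup H] [InnerProductSpace ℂ H] [CompleteSpace H]

theorem TranslationRep.Implements.conj_mem {U : TranslationRep H} {R : Net H} (h : U.Implements R)
    (a : Minkowski) {O : DoubleCone} {T : H →L[ℂ] H} (hT : T ∈ R.alg O) :
    U.op a * T * star (U.op a) ∈ R.alg (O.translate a) := by
  have := Set.mem_image_of_mem (fun T : H →L[ℂ] H => U.op a * T * star (U.op a)) hT
  rwa [h a O] at this

/-- In an irreducible net every nonzero vector is cyclic for the union of the local algebras. -/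
theorem Net.dense_of_irreducible {R : Net H} (hR : R.Irreducible) {Ω : H} (hΩ : Ω ≠ 0) :
    Dense {v : H | ∃ O : DoubleCone, ∃ B ∈ R.alg O, v = B Ω} := by
  have hmul : ∀ O₁ O₂ : DoubleCone, ∃ O : DoubleCone, R.alg O₁ ≤ R.alg O ∧ R.alg O₂ ≤ R.alg O := by
    intro O₁ O₂
    obtain ⟨O, h1, h2⟩ := DoubleCone.directed O₁ O₂
    exact ⟨O, R.isotony _ _ h1, R.isotony _ _ h2⟩
  have hsmul : ∀ (O : DoubleCone) (c : ℂ), ∀ B ∈ R.alg O, c • B ∈ R.alg O := fun O c B hB =>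
    (R.alg O).toStarSubalgebra.smul_mem hB c
  let O₀ : DoubleCone := ⟨_, isDoubleCone_centeredCone 0 one_pos⟩
  let W : Submodule ℂ H :=
    { carrier := {v : H | ∃ O : DoubleCone, ∃ B ∈ R.alg O, v = B Ω}
      zero_mem' := ⟨O₀, 0, zero_mem _, rfl⟩
      add_mem' := by
        rintro _ _ ⟨O₁, B₁, h1, rfl⟩ ⟨O₂, B₂, h2, rfl⟩
        obtain ⟨O, g1, g2⟩ := hmul O₁ O₂
        exact ⟨O, B₁ + B₂, add_mem (g1 h1) (g2 h2), rfl⟩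
      smul_mem' := by
        rintro c _ ⟨O, B, hB, rfl⟩
        exact ⟨O, c • B, hsmul O c B hB, rfl⟩ }
  let K := W.topologicalClosure
  have hK : IsClosed (K : Set H) := W.isClosed_topologicalClosure
  have : CompleteSpace K := hK.completeSpace_coe
  have hinv : ∀ O : DoubleCone, ∀ B ∈ R.alg O, ∀ v ∈ K, B v ∈ K := by
    intro O B hB v hv
    have hW : ∀ v ∈ W, B v ∈ W := by
      rintro _ ⟨O', B', hB', rfl⟩
      obtain ⟨O₂, g1, g2⟩ := hmul O O'
      exact ⟨O₂, B * B', mul_mem (g1 hB) (g2 hB'), rfl⟩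
    exact map_mem_closure B.continuous hv hW
  -- `K` is invariant under a star-closed family, so its projection lies in the commutant and is a
  -- scalar; fixing `Ω ≠ 0` makes it the identity.
  have hP : K.starProjection ∈ Set.centralizer (⋃ O : DoubleCone, (R.alg O : Set (H →L[ℂ] H))) := by
    rw [Set.mem_centralizer_iff]
    intro B hB
    obtain ⟨O, hB⟩ := Set.mem_iUnion.1 hB
    ext v
    change B (K.starProjection v) = K.starProjection (B v)
    symm
    refine Submodule.eq_starProjection_of_mem_orthogonal (hinv O B hB _ (by simp)) ?_
    rw [← map_sub, Submodule.mem_orthogonal]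
    intro u hu
    rw [← ContinuousLinearMap.adjoint_inner_left, ← ContinuousLinearMap.star_eq_adjoint]
    exact (K.sub_starProjection_mem_orthogonal v) _ (hinv O _ (star_mem hB) u hu)
  rw [hR] at hP
  obtain ⟨c, hc⟩ := hP
  have hΩK : Ω ∈ K := W.le_topologicalClosure ⟨O₀, 1, one_mem _, rfl⟩
  have h1 : K.starProjection Ω = Ω := Submodule.starProjection_eq_self_iff.2 hΩK
  rw [← hc] at h1
  have hc1 : c = 1 := by
    have h2 : (c - 1) • Ω = 0 := by
      rw [sub_smul, one_smul, sub_eq_zero]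
      exact h1
    exact sub_eq_zero.1 ((smul_eq_zero.1 h2).resolve_right hΩ)
  intro v
  have h3 : K.starProjection v = v := by
    rw [← hc, hc1]
    exact one_smul ℂ v
  exact Submodule.starProjection_eq_self_iff.1 h3

/-- Local algebras at points of an irreducible vacuum net are trivial. -/
theorem Net.iInter_alg_eq {R : Net H} {U : TranslationRep H} {Ω : H} (hR : R.Irreducible)
    (hloc : R.Microcausal) (hUR : U.Implements R) (hU : U.SpectrumCondition) (hΩ0 : Ω ≠ 0)
    (hΩ : U.Invariant Ω) (x : Minkowski) :
    (⋂ O : {O : DoubleCone // x ∈ O.1}, (R.alg O.1 : Set (H →L[ℂ] H))) =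
      Set.range fun c : ℂ => c • (1 : H →L[ℂ] H) := by
  apply Set.Subset.antisymm
  swap
  · rintro _ ⟨c, rfl⟩
    exact Set.mem_iInter.2 fun O => (R.alg O.1).toStarSubalgebra.smul_mem (one_mem _) c
  intro A hA
  have hA : ∀ O : DoubleCone, x ∈ O.1 → A ∈ R.alg O := fun O hO => Set.mem_iInter.1 hA ⟨O, hO⟩
  have hAΩ : U.Invariant (A Ω) := by
    refine U.invariant_of_commute hU hΩ fun y hy => ?_
    obtain ⟨O, hxO, hO⟩ := exists_spacelikeSep_translate x hy
    exact hloc _ _ hO _ (hA O hxO) _ (hUR.conj_mem y (star_mem (hA O hxO)))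
  have key : ∀ O : DoubleCone, ∀ B ∈ R.alg O, A (B Ω) = B (A Ω) := by
    intro O B hB
    obtain ⟨O', L, hx, hL⟩ := exists_far_spacelikeSep x O
    -- For `y` in the far region, `U(-y) A U(y)` commutes with `B`; applied to `Ω`, with `Ω` and `A
    -- Ω` both invariant, this is `A U(y) B Ω = U(y) B A Ω`.
    refine U.eq_of_eq_far hU (L := L) fun y h0 h1 => ?_
    have h2 := DFunLike.congr_fun (hloc _ _ (hL (-y) (by simpa using h0) (by simpa using le_neg.1 h1)) _
      (hUR.conj_mem (-y) (hA O' hx)) _ hB) Ω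
    rw [U.star_op, neg_neg] at h2
    change U.op (-y) (A (U.op y (B Ω))) = B (U.op (-y) (A (U.op y Ω))) at h2
    rw [hΩ, hAΩ] at h2
    rw [← h2, U.op_op_neg_apply]
  rw [← hR, Set.mem_centralizer_iff]
  intro B hB
  obtain ⟨O, hB⟩ := Set.mem_iUnion.1 hB
  -- On `C Ω` both orders give `B C A Ω`, by `key` for `C` and for `B C`.
  refine DFunLike.coe_injective ((B * A).continuous.ext_on (Net.dense_of_irreducible hR hΩ0) (A * B).continuous ?_)
  rintro _ ⟨O', C, hC, rfl⟩
  change B (A (C Ω)) = A (B (C Ω))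
  obtain ⟨O₂, g1, g2⟩ := DoubleCone.directed O O'
  rw [key O' C hC]
  exact (key O₂ (B * C) (mul_mem (R.isotony _ _ g1 hB) (R.isotony _ _ g2 hC))).symm

end Rep

end AQFT

end

theorem mainTheorem12 {H : Type*} [NormedAddCommGroup H] [InnerProductSpace ℂ H]
    [CompleteSpace H] :
    -- fields of bounded operators at points
    (∀ (A : AQFT.Minkowski → (H →L[ℂ] H)) (U : AQFT.TranslationRep H) (Ω : H),
      (∀ x y : AQFT.Minkowski, AQFT.SpacelikeSep x y →
        A x * A y = A y * A x ∧ A x * star (A y) = star (A y) * A x) →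
      (∀ x y : AQFT.Minkowski, U.op x * A y * star (U.op x) = A (y - x)) →
      U.SpectrumCondition →
      Ω ≠ 0 → U.Invariant Ω → (∀ v : H, U.Invariant v → ∃ c : ℂ, v = c • Ω) →
      ∃ c : ℂ, ∀ x : AQFT.Minkowski, A x Ω = c • Ω) ∧
    -- local algebras at points
    (∀ (R : AQFT.Net H) (U : AQFT.TranslationRep H) (Ω : H),
      R.Irreducible → R.Microcausal → U.Implements R → U.SpectrumCondition →
      Ω ≠ 0 → U.Invariant Ω →
      ∀ x : AQFT.Minkowski,
        (⋂ O : {O : AQFT.DoubleCone // x ∈ O.1}, (R.alg O.1 : Set (H →L[ℂ] H))) =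
          Set.range fun c : ℂ => c • (1 : H →L[ℂ] H)) :=
  ⟨fun _ U _ hA hUA hU _ hΩ huniq =>
    U.exists_apply_eq_smul hU (fun x y h => (hA x y h).2) hUA hΩ huniq,
   fun _ _ _ hR hloc hUR hU hΩ0 hΩ x => AQFT.Net.iInter_alg_eq hR hloc hUR hU hΩ0 hΩ x⟩
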